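/- Let $\alpha,\beta\in\mathbb{C}$ with $\operatorname{Re}\alpha>0$, $\operatorname{Re}\beta>0$, let $\mathcal{A}(z)=\sum_{n\ge 0}a_nz^n$ be an entire function with complex coefficients, and let $\varphi:[0,\infty)\to[0,\infty)$ be an increasing (not necessarily strictly) $C^1$ function with $\varphi(0)=0$. For $u:[0,\infty)\to\mathbb{C}$ define the generalised fractional integral $${}^{\mathcal{A}}_{0}I^{\alpha,\beta}_{\varphi(x)}u(x)=\int_0^x\varphi'(t)\,[\varphi(x)-\varphi(t)]^{\alpha-1}\,\mathcal{A}\big([\varphi(x)-\varphi(t)]^{\beta}\big)\,u(t)\,dt ,$$ the Laplace transform with respect to $\varphi$ $$\hat u(s)=\int_0^\infty e^{-s\varphi(x)}\varphi'(x)u(x)\,dx ,$$ and the transformed series $\mathcal{A}_\Gamma(z)=\sum_{n\ge0}a_n\Gamma(\beta n+\alpha)z^n$. Powers are principal ones. A function $f$ is piecewise continuous if it has only finitely many discontinuities in each $[0,T]$ and finite one-sided limits everywhere; it is of $\varphi$-exponential order if there are $\kappa,M,X>0$ with $|f(x)|\le Me^{\kappa\varphi(x)}$ for all $x>X$. **Theorem.**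 Let $c\in\mathbb{R}$, $c\neq0$, and let $v:[0,\infty)\to\mathbb{C}$ be piecewise continuous and of $\varphi$-exponential order. Then there is a piecewise continuous function $u:[0,\infty)\to\mathbb{C}$ such that $${}^{\mathcal{A}}_{0}I^{\alpha,\beta}_{\varphi(x)}u(x)+c\,u(x)=v(x)\quad(x\ge0),\qquad u(0)=\frac{v(0)}{c},$$ and $u$ is the only solution: every measurable $w:[0,\infty)\to\mathbb{C}$ with $\int_0^b|w|\varphi'\,dx<\infty$ for all $b>0$, for which the integral above converges for every $x\ge0$ and which satisfies these equations, is equal to $u$ at every point of $[0,\infty)$. Moreover, suppose that $\varphi(x)\to\infty$ as $x\to\infty$ and that the power series $\mathcal{A}_\Gamma$ has a positive radius of convergence. Then $u$ is of $\varphi$-exponential order, and there is $\sigma>0$ such that, for all $s\in\mathbb{C}$ with $\operatorname{Re}s>\sigma$, the integrals $\hat u(s)$ and $\hat v(s)$ converge absolutely, the series $\mathcal{A}_\Gamma(s^{-\beta})$ converges, $s^{-\alpha}\mathcal{A}_\Gamma(s^{-\beta})+c\neq0$, and $$\hat u(s)=\frac{\hat v(s)}{s^{-\alpha}\mathcal{A}_\Gamma(s^{-\beta})+c}.$$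 This transform determines $u$: if $w:[0,\infty)\to\mathbb{C}$ is such that, for all $s$ with sufficiently large real part, $\hat w(s)$ converges absolutely and equals the right-hand side above, then $w(x)=u(x)$ for almost every $x\ge0$ with $\varphi'(x)\ne0$. -/

import Mathlib

open Set Filter Topology MeasureTheory

noncomputable section

namespace GenFrac

/-- The derivative of `φ` on the half-line `[0, ∞)` (one-sided at `0`). -/
def dphi (φ : ℝ → ℝ) (x : ℝ) : ℝ := derivWithin φ (Ici 0) x

/-- A non-negative increasing `C¹` function on `[0, ∞)` with `φ(0) = 0`
(non-negativity follows from the other two properties). -/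
structure IsWeight (φ : ℝ → ℝ) : Prop where
  contDiffOn : ContDiffOn ℝ 1 φ (Ici 0)
  monotoneOn : MonotoneOn φ (Ici 0)
  map_zero : φ 0 = 0

/-- The integrand `φ'(t) [φ(x) - φ(t)]^(α-1) 𝒜([φ(x) - φ(t)]^β) u(t)`. -/
def integrand (A : ℂ → ℂ) (φ : ℝ → ℝ) (α β : ℂ) (u : ℝ → ℂ) (x t : ℝ) : ℂ :=
  (dphi φ t : ℂ) * ((φ x - φ t : ℝ) : ℂ) ^ (α - 1) * A (((φ x - φ t : ℝ) : ℂ) ^ β) * u t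

/-- The generalised fractional integral of `u` with analytic kernel `A`, with respect to `φ`,
with constant of integration `0`. -/
def fracIntegral (A : ℂ → ℂ) (φ : ℝ → ℝ) (α β : ℂ) (u : ℝ → ℂ) (x : ℝ) : ℂ :=
  ∫ t in (0 : ℝ)..x, integrand A φ α β u x t

/-- The `n`-th term `aₙ Γ(β n + α) zⁿ` of the transformed series. -/
def gammaTerm (a : ℕ → ℂ) (α β z : ℂ) (n : ℕ) : ℂ :=
  a n * Complex.Gamma (β * n + α) * z ^ n

/-- The transformed function `𝒜_Γ(z) = ∑ aₙ Γ(β n + α) zⁿ`. -/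
def gammaTransform (a : ℕ → ℂ) (α β z : ℂ) : ℂ := ∑' n, gammaTerm a α β z n

/-- Piecewise continuity on every finite interval `[0, T]`: finitely many discontinuities there,
and finite one-sided limits everywhere. -/
structure PiecewiseContinuous (f : ℝ → ℂ) : Prop where
  finite_disc : ∀ T : ℝ, {x ∈ Icc 0 T | ¬ ContinuousWithinAt f (Ici 0) x}.Finite
  right_lim : ∀ x : ℝ, 0 ≤ x → ∃ l, Tendsto f (𝓝[>] x) (𝓝 l)
  left_lim : ∀ x : ℝ, 0 < x → ∃ l, Tendsto f (𝓝[<] x) (𝓝 l)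

/-- `f` is of `φ`-exponential order (for some positive order `κ`). -/
def ExpOrder (φ : ℝ → ℝ) (f : ℝ → ℂ) : Prop :=
  ∃ κ > (0 : ℝ), ∃ M > (0 : ℝ), ∃ X > (0 : ℝ), ∀ x > X, ‖f x‖ ≤ M * Real.exp (κ * φ x)

/-- `f` belongs to the weighted space `L¹_φ[0, b]` for every `b > 0`. -/
def LocL1 (φ : ℝ → ℝ) (f : ℝ → ℂ) : Prop :=
  ∀ b > (0 : ℝ), AEStronglyMeasurable f (volume.restrict (Icc 0 b)) ∧
    IntegrableOn (fun x => (dphi φ x : ℂ) * f x) (Icc 0 b)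

def laplaceIntegrand (φ : ℝ → ℝ) (f : ℝ → ℂ) (s : ℂ) (x : ℝ) : ℂ :=
  Complex.exp (-s * (φ x : ℂ)) * (dphi φ x : ℂ) * f x

/-- The integral defining the Laplace transform with respect to `φ` converges at `s`. -/
def LaplaceConverges (φ : ℝ → ℝ) (f : ℝ → ℂ) (s : ℂ) : Prop :=
  IntegrableOn (laplaceIntegrand φ f s) (Ioi 0)

/-- The Laplace transform of `f` with respect to `φ`. -/
def laplace (φ : ℝ → ℝ) (f : ℝ → ℂ) (s : ℂ) : ℂ :=
  ∫ x in Ioi (0 : ℝ), laplaceIntegrand φ f s x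

/-- `u` solves `₀I u + c u = v` on `[0, ∞)`, `u(0) = v(0) / c`: it lies in `L¹_φ[0, b]` for all
`b`, the integrals converge, and the equation holds at every `x ≥ 0`. -/
structure IsSolution (A : ℂ → ℂ) (φ : ℝ → ℝ) (α β : ℂ) (c : ℝ) (v u : ℝ → ℂ) : Prop where
  locL1 : LocL1 φ u
  converges : ∀ x : ℝ, 0 ≤ x → IntervalIntegrable (integrand A φ α β u x) volume 0 x
  equation : ∀ x : ℝ, 0 ≤ x → fracIntegral A φ α β u x + (c : ℂ) * u x = v x
  initial : u 0 = v 0 / (c : ℂ)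

end GenFrac

end

/-! The substitution `y = φ x` turns the equation into a Volterra convolution equation of the second
kind, `K ⋆ U + c U = V` on the half-line, with `K = kern A α β` and `U`, `V` the functions `pull φ
u`, `pull φ v`. Although `φ` need not be injective, two distinct points with the same image both
have `φ' = 0` (`IsWeight.dphi_eq_zero`), so the weight `φ'` hides the choice of representative made
by `pull`.

Since `K` is locally integrable and vanishes on `y ≤ 0`, multiplying it by `e^(-r y)` makes its `L¹`
norm as small as desired (truncating `K` first when it is only locally integrable), and convolution
commutes with this damping (`conv_damp`). Smallness against `|c|` gives existence on bounded
intervals by contraction (`exists_fixedPoint_conv`), uniqueness by an `L¹` estimate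
(`IsVolterraKernel.eq_zero_of_conv_eq`), hence a global solution by gluing, and an exponential bound
(`norm_conv_le_exp_of_solution`). Points where `φ' = 0` are settled afterwards: the convolution term
depends only on `φ x`, and the equation itself then gives `u x`.

The Laplace transform of `K` is computed termwise in `laplace_kern`. Absolute convergence there
involves `Γ(Re(β n + α))`, while the hypothesis on `𝒜_Γ` controls only `|Γ(β n + α)|`;
`exists_gamma_re_le` bridges the two at the cost of a geometric factor, which a larger `Re s`
absorbs. The transform formula is then the convolution theorem, and recovery of `u` is Fourier
injectivity on a vertical line. -/

noncomputable section

namespace GenFrac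

/-! ### Gamma function estimates and the Euler integral with complex rate -/

section GammaBounds

/-- Telescoping against `1/(x+n) - 1/(x+n+1)`; the negative last term is kept so that the induction
closes. -/
theorem sum_inv_add_sq_le {x : ℝ} (hx : 0 < x) (n : ℕ) :
    ∑ j ∈ Finset.range (n + 1), 1 / (x + j) ^ 2 ≤ 1 / x ^ 2 + 1 / x - 1 / (x + n) := by
  induction n with
  | zero => simp
  | succ n ih =>
    rw [Finset.sum_range_succ]
    have h1 : 0 < x + n := by positivity
    have h2 : 1 / (x + (n + 1 : ℕ)) ^ 2 ≤ 1 / (x + n) - 1 / (x + (n + 1 : ℕ)) := by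
      push_cast
      rw [div_sub_div _ _ (by positivity) (by positivity), div_le_div_iff₀ (by positivity)
        (by positivity)]
      nlinarith
    linarith

/-- Compare Euler's approximants `GammaSeq` at `z = x + iy` and at `x`. The numerators have equal
modulus, and `|z+j|² = (x+j)² (1 + y²/(x+j)²) ≤ (x+j)² exp(y²/(x+j)²)`; the exponents sum to a
quantity bounded uniformly in `n`. -/
theorem gamma_re_le_norm_gamma {z : ℂ} (hz : 0 < z.re) :
    Real.Gamma z.re ≤ ‖Complex.Gamma z‖ *
      Real.exp (z.im ^ 2 * (1 / z.re ^ 2 + 1 / z.re) / 2) := by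
  have h1 := Real.GammaSeq_tendsto_Gamma z.re
  have h2 := (Complex.GammaSeq_tendsto_Gamma z).norm.mul_const
    (Real.exp (z.im ^ 2 * (1 / z.re ^ 2 + 1 / z.re) / 2))
  refine le_of_tendsto_of_tendsto h1 h2 ?_
  filter_upwards [eventually_gt_atTop 0] with n hn
  have hpos : ∀ j : ℕ, 0 < z.re + j := fun j => by positivity
  have hne : ∀ j : ℕ, z + j ≠ 0 := fun j h => by
    have := congrArg Complex.re h
    simp at this
    linarith [hpos j]
  rw [Real.GammaSeq, Complex.GammaSeq, norm_div, norm_mul, norm_prod,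
    Complex.norm_natCast_cpow_of_pos hn, Complex.norm_natCast, div_mul_eq_mul_div,
    div_le_div_iff₀ (Finset.prod_pos fun j _ => hpos j)
      (Finset.prod_pos fun j _ => norm_pos_iff.2 (hne j)),
    mul_assoc _ (Real.exp _)]
  refine mul_le_mul_of_nonneg_left ?_ (by positivity)
  have key : ∀ j : ℕ, ‖z + j‖ ≤ (z.re + j) * Real.exp (z.im ^ 2 * (1 / (z.re + j) ^ 2) / 2) := by
    intro j
    have hp := hpos j
    refine (pow_le_pow_iff_left₀ (norm_nonneg _) (by positivity) two_ne_zero).1 ?_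
    rw [← Complex.normSq_eq_norm_sq, Complex.normSq_apply, mul_pow, ← Real.exp_nat_mul]
    have h3 := Real.add_one_le_exp (z.im ^ 2 * (1 / (z.re + j) ^ 2))
    have h4 : ((2 : ℕ) : ℝ) * (z.im ^ 2 * (1 / (z.re + j) ^ 2) / 2)
      = z.im ^ 2 * (1 / (z.re + j) ^ 2) := by push_cast; ring
    rw [h4]
    calc (z + j).re * (z + j).re + (z + j).im * (z + j).im
        = (z.re + j) ^ 2 * (z.im ^ 2 * (1 / (z.re + j) ^ 2) + 1) := by
          simp; field_simp; ring
      _ ≤ _ := by gcongr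
  calc ∏ j ∈ Finset.range (n + 1), ‖z + j‖
      ≤ ∏ j ∈ Finset.range (n + 1),
        ((z.re + j) * Real.exp (z.im ^ 2 * (1 / (z.re + j) ^ 2) / 2)) :=
        Finset.prod_le_prod (fun _ _ => norm_nonneg _) fun j _ => key j
    _ = Real.exp (∑ j ∈ Finset.range (n + 1), z.im ^ 2 * (1 / (z.re + j) ^ 2) / 2) *
        ∏ j ∈ Finset.range (n + 1), (z.re + j) := by
        rw [Finset.prod_mul_distrib, Real.exp_sum, mul_comm]
    _ ≤ _ := by
        refine mul_le_mul_of_nonneg_right (Real.exp_le_exp.2 ?_)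
          (Finset.prod_nonneg fun j _ => (hpos j).le)
        rw [← Finset.sum_div, ← Finset.mul_sum]
        have := sum_inv_add_sq_le hz n
        have h5 : 0 ≤ 1 / (z.re + n) := by positivity
        gcongr
        linarith

/-- Along an arithmetic progression in the right half-plane the Gamma function at the real part is
dominated by the absolute value of the Gamma function, up to a geometric factor. -/
theorem exists_gamma_re_le {α β : ℂ} (hα : 0 < α.re) (hβ : 0 < β.re) :
    ∃ E > (0 : ℝ), ∃ q > (0 : ℝ), ∀ n : ℕ,
      Real.Gamma (β.re * n + α.re) ≤ ‖Complex.Gamma (β * n + α)‖ * (E * q ^ n) := by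
  -- With this `C`, `|Im| ≤ C Re` along the whole progression, so the exponent in
  -- `gamma_re_le_norm_gamma` is at most `C² (1 + x) / 2`, which is affine in `n`: hence the
  -- geometric factor.
  set C : ℝ := |β.im| / β.re + |α.im| / α.re with hC
  have hC0 : 0 ≤ C := by positivity
  refine ⟨Real.exp (C ^ 2 * (1 + α.re) / 2), Real.exp_pos _, Real.exp (C ^ 2 * β.re / 2),
    Real.exp_pos _, fun n => ?_⟩
  have hre : (β * n + α).re = β.re * n + α.re := by simp
  have him : (β * n + α).im = β.im * n + α.im := by simp
  have hx : 0 < β.re * n + α.re := by positivity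
  have h1 := gamma_re_le_norm_gamma (z := β * n + α) (by rw [hre]; exact hx)
  rw [hre, him] at h1
  refine h1.trans (mul_le_mul_of_nonneg_left ?_ (norm_nonneg _))
  rw [← Real.exp_nat_mul, ← Real.exp_add, Real.exp_le_exp]
  set x := β.re * n + α.re
  have hy : |β.im * n + α.im| ≤ C * x := by
    have e1 : |β.im * n + α.im| ≤ |β.im| * n + |α.im| := by
      refine (abs_add_le _ _).trans ?_
      rw [abs_mul, Nat.abs_cast]
    have e2 : C * x = |β.im| * n + |α.im| + (|β.im| / β.re * α.re + |α.im| / α.re * (β.re * n)) := by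
      simp only [hC, x]; field_simp; ring
    have e3 : 0 ≤ |β.im| / β.re * α.re + |α.im| / α.re * (β.re * n) := by positivity
    linarith
  have hy2 : (β.im * n + α.im) ^ 2 ≤ (C * x) ^ 2 := by
    rw [← sq_abs]; gcongr
  have h2 : (β.im * n + α.im) ^ 2 * (1 / x ^ 2 + 1 / x) ≤ C ^ 2 * (1 + x) := by
    calc _ ≤ (C * x) ^ 2 * (1 / x ^ 2 + 1 / x) := by gcongr
      _ = _ := by field_simp
  have h3 : C ^ 2 * (1 + x) / 2 = n * (C ^ 2 * β.re / 2) + C ^ 2 * (1 + α.re) / 2 := by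
    simp only [x]; ring
  linarith

theorem norm_cpow_mul_exp {z s : ℂ} {y : ℝ} (hy : 0 < y) :
    ‖(y : ℂ) ^ (z - 1) * Complex.exp (-(s * y))‖ = y ^ (z.re - 1) * Real.exp (-(s.re * y)) := by
  rw [norm_mul, Complex.norm_cpow_eq_rpow_re_of_pos hy, Complex.norm_exp]
  simp

theorem integrableOn_rpow_mul_exp {a r : ℝ} (ha : 0 < a) (hr : 0 < r) :
    IntegrableOn (fun y : ℝ => y ^ (a - 1) * Real.exp (-(r * y))) (Ioi 0) := by
  have h := integrableOn_rpow_mul_exp_neg_mul_rpow (p := 1) (s := a - 1) (b := r) (by linarith)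
    one_pos hr
  simpa [neg_mul] using h

theorem integrableOn_cpow_mul_exp {z s : ℂ} (hz : 0 < z.re) (hs : 0 < s.re) :
    IntegrableOn (fun y : ℝ => (y : ℂ) ^ (z - 1) * Complex.exp (-(s * y))) (Ioi 0) := by
  refine (integrableOn_rpow_mul_exp hz hs).mono' ?_ ?_
  · exact (by fun_prop : Measurable _).aestronglyMeasurable
  · filter_upwards [self_mem_ae_restrict measurableSet_Ioi] with y hy
    exact (norm_cpow_mul_exp hy).le

theorem hasDerivAt_integral_cpow_mul_exp {z s : ℂ} (hz : 0 < z.re) (hs : 0 < s.re) :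
    HasDerivAt (fun s : ℂ => ∫ y in Ioi (0 : ℝ), (y : ℂ) ^ (z - 1) * Complex.exp (-(s * y)))
      (∫ y in Ioi (0 : ℝ), (y : ℂ) ^ (z - 1) * (Complex.exp (-(s * y)) * -y)) s := by
  -- On this neighbourhood `e^(-(Re s / 2) y)` dominates uniformly.
  have hnhds : {w : ℂ | s.re / 2 < w.re} ∈ 𝓝 s :=
    (isOpen_lt continuous_const Complex.continuous_re).mem_nhds (by simp; linarith)
  refine (hasDerivAt_integral_of_dominated_loc_of_deriv_le
    (μ := volume.restrict (Ioi (0 : ℝ)))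
    (F := fun s y => (y : ℂ) ^ (z - 1) * Complex.exp (-(s * y)))
    (F' := fun s y => (y : ℂ) ^ (z - 1) * (Complex.exp (-(s * y)) * -y))
    (bound := fun y => y ^ (z.re + 1 - 1) * Real.exp (-(s.re / 2 * y))) hnhds ?_
    (integrableOn_cpow_mul_exp hz hs) ?_ ?_ ?_ ?_).2
  · exact Eventually.of_forall fun w => (by fun_prop : Measurable _).aestronglyMeasurable
  · exact (by fun_prop : Measurable _).aestronglyMeasurable
  · filter_upwards [self_mem_ae_restrict measurableSet_Ioi] with y hy w hw
    have hy' : (0 : ℝ) < y := hy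
    rw [← mul_assoc, norm_mul, norm_cpow_mul_exp hy', norm_neg, Complex.norm_real,
      Real.norm_of_nonneg hy'.le, add_sub_cancel_right, mul_right_comm, ← Real.rpow_add_one hy'.ne',
      sub_add_cancel]
    have : s.re / 2 < w.re := hw
    gcongr
  · exact integrableOn_rpow_mul_exp (by linarith) (by linarith)
  · filter_upwards with y w _
    have h : HasDerivAt (fun w : ℂ => -(w * y)) (-y : ℂ) w := (hasDerivAt_mul_const (y : ℂ)).fun_neg
    exact (h.cexp).const_mul _

/-- Both sides are holomorphic in `s` on the right half-plane and agree for real `s > 0`, in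
particular along `1 + 1/(n+1) → 1`; the identity theorem does the rest. -/
theorem integral_cpow_mul_exp {z s : ℂ} (hz : 0 < z.re) (hs : 0 < s.re) :
    ∫ y in Ioi (0 : ℝ), (y : ℂ) ^ (z - 1) * Complex.exp (-(s * y)) =
      s ^ (-z) * Complex.Gamma z := by
  have hopen : IsOpen {w : ℂ | 0 < w.re} := isOpen_lt continuous_const Complex.continuous_re
  have hconv : IsPreconnected {w : ℂ | 0 < w.re} := (convex_halfSpace_re_gt 0).isPreconnected
  have hf : AnalyticOnNhd ℂ
      (fun s : ℂ => ∫ y in Ioi (0 : ℝ), (y : ℂ) ^ (z - 1) * Complex.exp (-(s * y)))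
      {w : ℂ | 0 < w.re} :=
    DifferentiableOn.analyticOnNhd (fun w hw =>
      (hasDerivAt_integral_cpow_mul_exp hz hw).differentiableAt.differentiableWithinAt) hopen
  have hg : AnalyticOnNhd ℂ (fun s : ℂ => s ^ (-z) * Complex.Gamma z) {w : ℂ | 0 < w.re} :=
    DifferentiableOn.analyticOnNhd (fun w hw =>
      ((differentiableAt_id.cpow_const (Or.inl hw)).mul_const _).differentiableWithinAt) hopen
  refine hf.eqOn_of_preconnected_of_frequently_eq hg hconv (z₀ := 1) (by simp) ?_ hs
  have hlim : Tendsto (fun n : ℕ => ((1 + 1 / ((n : ℝ) + 1) : ℝ) : ℂ)) atTop (𝓝[≠] 1) := by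
    refine tendsto_nhdsWithin_iff.2 ⟨?_, Eventually.of_forall fun n => ?_⟩
    · have h := (tendsto_one_div_add_atTop_nhds_zero_nat (𝕜 := ℝ)).const_add 1
      have h2 := (Complex.continuous_ofReal.tendsto _).comp h
      simpa [Function.comp_def] using h2
    · simp only [mem_compl_iff, mem_singleton_iff]
      have : (0 : ℝ) < 1 / ((n : ℝ) + 1) := by positivity
      rw [Complex.ofReal_eq_one]
      linarith
  refine hlim.frequently (Frequently.of_forall fun n => ?_)
  set r : ℝ := 1 + 1 / ((n : ℝ) + 1)
  have hr : 0 < r := by positivity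
  have h := Complex.integral_cpow_mul_exp_neg_mul_Ioi hz hr
  rw [h, Complex.cpow_neg, one_div, Complex.inv_cpow _ _ ?_]
  rw [Complex.arg_ofReal_of_nonneg hr.le]
  exact Real.pi_pos.ne

end GammaBounds

/-! ### Convolution, exponential damping and the contraction -/

section Convolution

/-- Convolution of complex functions on the line. -/
def conv (K F : ℝ → ℂ) (y : ℝ) : ℂ := ∫ t, K t * F (y - t)

/-- Multiplication by the exponential `e^(-s y)`. -/
def damp (s : ℂ) (F : ℝ → ℂ) (y : ℝ) : ℂ := Complex.exp (-(s * y)) * F y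

theorem conv_eq_convolution (K F : ℝ → ℂ) :
    conv K F = convolution K F (ContinuousLinearMap.mul ℝ ℂ) volume := rfl

theorem conv_swap (K F : ℝ → ℂ) (y : ℝ) : conv K F y = ∫ t, K (y - t) * F t := by
  rw [conv, ← integral_sub_left_eq_self _ volume y]
  simp

theorem norm_damp (s : ℂ) (F : ℝ → ℂ) (y : ℝ) :
    ‖damp s F y‖ = Real.exp (-(s.re * y)) * ‖F y‖ := by
  simp [damp, Complex.norm_exp]

theorem conv_damp (s : ℂ) (K F : ℝ → ℂ) (y : ℝ) :
    conv (damp s K) (damp s F) y = damp s (conv K F) y := by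
  rw [conv, damp, conv, ← integral_const_mul]
  refine integral_congr_ae (Eventually.of_forall fun t => ?_)
  have : Complex.exp (-(s * y)) = Complex.exp (-(s * t)) * Complex.exp (-(s * (y - t : ℝ))) := by
    rw [← Complex.exp_add]; congr 1; push_cast; ring
  simp only [damp, this]
  ring

theorem damp_aestronglyMeasurable {s : ℂ} {F : ℝ → ℂ} (hF : AEStronglyMeasurable F) :
    AEStronglyMeasurable (damp s F) :=
  (by fun_prop : Continuous fun y : ℝ => Complex.exp (-(s * y))).aestronglyMeasurable.mul hF

/-- Dominated convergence: on `y > 0` the weight `e^(-r y)` decreases to `0`. This is the source of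
every smallness condition on the kernel. -/
theorem tendsto_integral_norm_damp {K : ℝ → ℂ} (hK0 : ∀ y ≤ 0, K y = 0) {l : ℝ}
    (hK : Integrable (damp l K)) :
    Tendsto (fun r : ℝ => ∫ y, ‖damp r K y‖) atTop (𝓝 0) := by
  have h := tendsto_integral_filter_of_dominated_convergence (μ := volume) (l := atTop)
    (F := fun (r : ℝ) y => ‖damp r K y‖) (f := fun _ => (0 : ℝ)) (fun y => ‖damp l K y‖) ?_ ?_
    hK.norm ?_
  · simpa using h
  · refine Eventually.of_forall fun r => (AEStronglyMeasurable.norm ?_)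
    have : damp r K = damp (r - l) (damp l K) := by
      ext y
      simp only [damp, ← mul_assoc, ← Complex.exp_add]
      congr 2; ring
    rw [this]
    exact damp_aestronglyMeasurable hK.1
  · filter_upwards [eventually_ge_atTop l] with r hr
    refine Eventually.of_forall fun y => ?_
    rw [norm_norm, norm_damp, norm_damp]
    rcases le_or_gt y 0 with hy | hy
    · simp [hK0 y hy]
    · simp only [Complex.ofReal_re]
      gcongr
  · refine Eventually.of_forall fun y => ?_
    rcases le_or_gt y 0 with hy | hy
    · simp [norm_damp, hK0 y hy]
    · simp only [norm_damp, Complex.ofReal_re]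
      have h1 : Tendsto (fun r : ℝ => Real.exp (-(r * y))) atTop (𝓝 0) :=
        Real.tendsto_exp_neg_atTop_nhds_zero.comp (tendsto_id.atTop_mul_const hy)
      simpa using h1.mul_const ‖K y‖

theorem integrable_conv_integrand {K F : ℝ → ℂ} (hK : Integrable K)
    (hF : AEStronglyMeasurable F) {M : ℝ} (hM : ∀ y, ‖F y‖ ≤ M) (y : ℝ) :
    Integrable fun t => K t * F (y - t) := by
  refine hK.mul_bdd (c := M) ?_ (Eventually.of_forall fun t => hM _)
  exact hF.comp_quasiMeasurePreserving (quasiMeasurePreserving_sub_left_of_right_invariant volume y)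

theorem norm_conv_le {K F : ℝ → ℂ} (hK : Integrable K) {M : ℝ} (hM : ∀ y, ‖F y‖ ≤ M) (y : ℝ) :
    ‖conv K F y‖ ≤ (∫ t, ‖K t‖) * M := by
  rw [conv, ← integral_mul_const]
  refine norm_integral_le_of_norm_le (hK.norm.mul_const M) (Eventually.of_forall fun t => ?_)
  rw [norm_mul]
  exact mul_le_mul_of_nonneg_left (hM _) (norm_nonneg _)

theorem conv_sub_left {K K' F : ℝ → ℂ} (hK : Integrable K) (hK' : Integrable K')
    (hF : AEStronglyMeasurable F) {M : ℝ} (hM : ∀ y, ‖F y‖ ≤ M) (y : ℝ) :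
    conv K F y - conv K' F y = conv (K - K') F y := by
  rw [conv, conv, conv, ← integral_sub (integrable_conv_integrand hK hF hM y)
    (integrable_conv_integrand hK' hF hM y)]
  simp [sub_mul]

/-- Approximate `K` in `L¹` by continuous compactly supported kernels; as `F` is bounded, the
convolutions converge uniformly. -/
theorem continuous_conv {K F : ℝ → ℂ} (hK : Integrable K)
    (hF : AEStronglyMeasurable F) {M : ℝ} (hM : ∀ y, ‖F y‖ ≤ M) : Continuous (conv K F) := by
  have hM0 : 0 ≤ M := (norm_nonneg _).trans (hM 0)
  choose g hgc hgle hgcont hgint using fun n : ℕ =>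
    hK.exists_hasCompactSupport_integral_sub_le (Nat.one_div_pos_of_nat (α := ℝ) (n := n))
  have hFl : LocallyIntegrable F := fun x => by
    refine ⟨Icc (x - 1) (x + 1), Icc_mem_nhds (by linarith) (by linarith), ?_⟩
    exact Measure.integrableOn_of_bounded (M := M) (by simp) hF
      (Eventually.of_forall fun y => hM y)
  have hcont : ∀ n, Continuous (conv (g n) F) := fun n => by
    rw [conv_eq_convolution]
    exact (hgc n).continuous_convolution_left _ (hgcont n) hFl
  have hunif : TendstoUniformly (fun n => conv (g n) F) (conv K F) atTop := by
    rw [Metric.tendstoUniformly_iff]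
    intro ε hε
    have hlim : Tendsto (fun n : ℕ => 1 / ((n : ℝ) + 1) * M) atTop (𝓝 0) := by
      simpa using (tendsto_one_div_add_atTop_nhds_zero_nat (𝕜 := ℝ)).mul_const M
    filter_upwards [hlim.eventually (gt_mem_nhds hε)] with n hn y
    rw [dist_eq_norm, conv_sub_left hK (hgint n) hF hM]
    refine (norm_conv_le (hK.sub (hgint n)) hM y).trans_lt (lt_of_le_of_lt ?_ hn)
    exact mul_le_mul_of_nonneg_right (hgle n) hM0
  exact hunif.continuous (Frequently.of_forall hcont)

theorem integral_damp_conv {K F : ℝ → ℂ} {s : ℂ} (hK : Integrable (damp s K))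
    (hF : Integrable (damp s F)) :
    Integrable (damp s (conv K F)) ∧
      ∫ y, damp s (conv K F) y = (∫ y, damp s K y) * ∫ y, damp s F y := by
  have h : damp s (conv K F) = conv (damp s K) (damp s F) :=
    funext fun y => (conv_damp s K F y).symm
  rw [h, conv_eq_convolution]
  exact ⟨hK.integrable_convolution _ hF, integral_convolution _ hK hF⟩

/-- Fixed point of the contraction `G ↦ K ⋆ 1_{[0,∞)}(V - G) / c`. -/
theorem exists_fixedPoint_conv {K V : ℝ → ℂ} (hK : Integrable K) {c : ℂ}
    (hKc : ∫ t, ‖K t‖ < ‖c‖) (hV : AEStronglyMeasurable V) {M : ℝ} (hM : ∀ y, ‖V y‖ ≤ M) :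
    ∃ G : ℝ → ℂ, Continuous G ∧
      ∀ y, c * G y = conv K ((Ici 0).indicator fun y => V y - G y) y := by
  have hc : 0 < ‖c‖ := (integral_nonneg fun _ => norm_nonneg _).trans_lt hKc
  have hc' : c ≠ 0 := norm_pos_iff.1 hc
  have hM0 : 0 ≤ M := (norm_nonneg _).trans (hM 0)
  have hmeas : ∀ G : BoundedContinuousFunction ℝ ℂ,
      AEStronglyMeasurable ((Ici 0).indicator fun y => V y - G y) := fun G =>
    (hV.sub G.continuous.aestronglyMeasurable).indicator measurableSet_Ici
  have hbd : ∀ (G : BoundedContinuousFunction ℝ ℂ) (y : ℝ),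
      ‖(Ici 0).indicator (fun y => V y - G y) y‖ ≤ M + ‖G‖ := fun G y =>
    (norm_indicator_le_norm_self _ _).trans
      ((norm_sub_le _ _).trans (add_le_add (hM y) (G.norm_coe_le_norm y)))
  -- The unknown is `G = K ⋆ U` with `U = (V - G) / c` on the half-line, not `U` itself: `G` is
  -- continuous even where `V` jumps. In `T G - T H` the data `V` cancel, leaving the ratio `‖K‖₁ /
  -- |c|`.
  let T : BoundedContinuousFunction ℝ ℂ → BoundedContinuousFunction ℝ ℂ := fun G =>
    BoundedContinuousFunction.ofNormedAddCommGroup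
      (fun y => c⁻¹ * conv K ((Ici 0).indicator fun y => V y - G y) y)
      (continuous_const.mul (continuous_conv hK (hmeas G) (hbd G)))
      (‖c⁻¹‖ * ((∫ t, ‖K t‖) * (M + ‖G‖))) fun y => by
        rw [norm_mul]
        exact mul_le_mul_of_nonneg_left (norm_conv_le hK (hbd G) y) (norm_nonneg _)
  have hq0 : 0 ≤ (∫ t, ‖K t‖) / ‖c‖ := div_nonneg (integral_nonneg fun _ => norm_nonneg _) hc.le
  obtain ⟨q, hq⟩ : ∃ q : NNReal, (q : ℝ) = (∫ t, ‖K t‖) / ‖c‖ := ⟨⟨_, hq0⟩, rfl⟩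
  have hT : ContractingWith q T := by
    refine ⟨NNReal.coe_lt_coe.1 (by rw [hq]; exact (div_lt_one hc).2 hKc),
      LipschitzWith.of_dist_le_mul fun G H => ?_⟩
    rw [BoundedContinuousFunction.dist_le (by positivity)]
    intro y
    have e : T G y - T H y = c⁻¹ * conv K ((Ici 0).indicator fun y => H y - G y) y := by
      change c⁻¹ * conv K _ y - c⁻¹ * conv K _ y = _
      rw [← mul_sub, conv, conv, conv, ← integral_sub
        (integrable_conv_integrand hK (hmeas G) (hbd G) y)
        (integrable_conv_integrand hK (hmeas H) (hbd H) y)]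
      congr 1
      refine integral_congr_ae (Eventually.of_forall fun t => ?_)
      by_cases h : y - t ∈ Ici (0 : ℝ)
      · simp only [indicator_of_mem h]; ring
      · simp only [indicator_of_notMem h]; ring
    rw [dist_eq_norm, e, norm_mul, norm_inv]
    have hb : ∀ y, ‖(Ici 0).indicator (fun y => H y - G y) y‖ ≤ dist G H := fun y =>
      (norm_indicator_le_norm_self _ _).trans (by
        rw [← dist_eq_norm, dist_comm]; exact G.dist_coe_le_dist y)
    calc ‖c‖⁻¹ * ‖conv K ((Ici 0).indicator fun y => H y - G y) y‖
        ≤ ‖c‖⁻¹ * ((∫ t, ‖K t‖) * dist G H) := by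
          gcongr; exact norm_conv_le hK hb y
      _ = _ := by rw [hq]; ring
  obtain ⟨G, hG⟩ : ∃ G, T G = G := ⟨_, hT.fixedPoint_isFixedPt⟩
  refine ⟨G, G.continuous, fun y => ?_⟩
  have h2 : c⁻¹ * conv K ((Ici 0).indicator fun y => V y - G y) y = G y := DFunLike.congr_fun hG y
  nth_rewrite 1 [← h2]
  rw [mul_inv_cancel_left₀ hc']

end Convolution

/-! ### Volterra equations of the second kind on the half-line -/

section Volterra

@[simp] theorem damp_zero (F : ℝ → ℂ) : damp 0 F = F := by
  ext y; simp [damp]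

theorem damp_damp (s s' : ℂ) (F : ℝ → ℂ) : damp s (damp s' F) = damp (s + s') F := by
  ext y
  simp only [damp, ← mul_assoc, ← Complex.exp_add]
  congr 2; ring

theorem integrable_damp_of_re_le {K : ℝ → ℂ} (hK0 : ∀ y < 0, K y = 0) {s s' : ℂ}
    (hs : s.re ≤ s'.re) (hK : Integrable (damp s K)) : Integrable (damp s' K) := by
  refine hK.mono ?_ (Eventually.of_forall fun y => ?_)
  · have : damp s' K = damp (s' - s) (damp s K) := by rw [damp_damp]; simp
    rw [this]
    exact damp_aestronglyMeasurable hK.1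
  · rw [norm_damp, norm_damp]
    rcases lt_or_ge y 0 with hy | hy
    · simp [hK0 y hy]
    · gcongr

/-- Kernels of Volterra operators on the half-line: locally integrable, supported on `(0, ∞)`. -/
structure IsVolterraKernel (K : ℝ → ℂ) : Prop where
  eq_zero : ∀ y ≤ 0, K y = 0
  integrable : ∀ b : ℝ, Integrable ((Iic b).indicator K)

theorem conv_indicator_Iic {K F : ℝ → ℂ} (hF : ∀ y < 0, F y = 0) {b y : ℝ} (hy : y ≤ b) :
    conv ((Iic b).indicator K) F y = conv K F y := by
  refine integral_congr_ae (Eventually.of_forall fun t => ?_)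
  rcases le_or_gt t b with h | h
  · simp [h]
  · simp [hF (y - t) (by linarith)]

/-- Causality: the supports of the factors confine the integration to `0 < t ≤ y`. -/
theorem conv_congr_Icc {K F G : ℝ → ℂ} (hK : ∀ y ≤ 0, K y = 0) (hF : ∀ y < 0, F y = 0)
    (hG : ∀ y < 0, G y = 0) {y : ℝ} (h : ∀ z ∈ Icc 0 y, F z = G z) : conv K F y = conv K G y := by
  refine integral_congr_ae (Eventually.of_forall fun t => ?_)
  rcases le_or_gt t 0 with ht | ht
  · simp [hK t ht]
  · rcases lt_or_ge (y - t) 0 with h1 | h1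
    · simp [hF _ h1, hG _ h1]
    · simp [h (y - t) ⟨h1, by linarith⟩]

theorem IsVolterraKernel.integrable_conv_integrand {K F : ℝ → ℂ} (hK : IsVolterraKernel K)
    (hF : AEStronglyMeasurable F) (hF0 : ∀ y < 0, F y = 0) {M y : ℝ} (hM0 : 0 ≤ M)
    (hM : ∀ z ∈ Icc 0 y, ‖F z‖ ≤ M) : Integrable fun t => K t * F (y - t) := by
  have h := GenFrac.integrable_conv_integrand (hK.integrable y)
    (hF.indicator (measurableSet_Icc (a := (0 : ℝ)) (b := y))) (M := M) (fun z => ?_) y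
  · refine h.congr (Eventually.of_forall fun t => ?_)
    rcases le_or_gt t 0 with ht | ht
    · simp [hK.eq_zero t ht, indicator]
    · rcases lt_or_ge (y - t) 0 with h1 | h1
      · simp [hF0 _ h1, indicator]
      · have h2 : y - t ∈ Icc 0 y := ⟨h1, by linarith⟩
        have h3 : t ∈ Iic y := by simp; linarith
        simp only [indicator_of_mem h2, indicator_of_mem h3]
  · by_cases hz : z ∈ Icc 0 y
    · rw [indicator_of_mem hz]; exact hM z hz
    · rw [indicator_of_notMem hz]; simpa using hM0

theorem exists_integral_norm_damp_lt {K : ℝ → ℂ} (hK0 : ∀ y ≤ 0, K y = 0) {l : ℝ}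
    (hK : Integrable (damp l K)) {ε : ℝ} (hε : 0 < ε) (m : ℝ) :
    ∃ r : ℝ, m ≤ r ∧ Integrable (damp r K) ∧ ∫ y, ‖damp r K y‖ < ε := by
  obtain ⟨r, h1, h2, h3⟩ := ((tendsto_integral_norm_damp hK0 hK).eventually (gt_mem_nhds hε)
    |>.and ((eventually_ge_atTop m).and (eventually_ge_atTop l))).exists
  exact ⟨r, h2, integrable_damp_of_re_le (fun y hy => hK0 y hy.le) (by simpa using h3) hK, h1⟩

theorem IsVolterraKernel.exists_damp_lt {K : ℝ → ℂ} (hK : IsVolterraKernel K) (b : ℝ) {ε : ℝ}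
    (hε : 0 < ε) (m : ℝ) : ∃ r : ℝ, m ≤ r ∧ Integrable (damp r ((Iic b).indicator K)) ∧
      ∫ y, ‖damp r ((Iic b).indicator K) y‖ < ε := by
  refine exists_integral_norm_damp_lt (fun y hy => ?_) (l := 0) (by simpa using hK.integrable b)
    hε m
  simp [indicator, hK.eq_zero y hy]

/-- Uniqueness for Volterra equations of the second kind. -/
theorem IsVolterraKernel.eq_zero_of_conv_eq {K D : ℝ → ℂ} (hK : IsVolterraKernel K) {c : ℂ}
    (hc : c ≠ 0) {b : ℝ} (hD : Integrable D) (hD0 : ∀ y ∉ Icc 0 b, D y = 0)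
    (h : ∀ y ∈ Icc 0 b, conv K D y + c * D y = 0) (y : ℝ) : D y = 0 := by
  have hDneg : ∀ y < 0, D y = 0 := fun y hy => hD0 y fun h => by linarith [h.1]
  obtain ⟨r, hr0, hri, hrc⟩ := hK.exists_damp_lt b (norm_pos_iff.2 hc) 0
  set K' := damp r ((Iic b).indicator K)
  have hfi : Integrable (damp r D) := integrable_damp_of_re_le (s := 0) hDneg
    (by simpa using hr0) (by simpa using hD)
  have hconv : ∀ y ∈ Icc 0 b, c * damp r D y = - conv K' (damp r D) y := fun y hy => by
    rw [conv_damp]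
    simp only [damp]
    rw [conv_indicator_Iic hDneg hy.2]
    linear_combination (Complex.exp (-(r * y))) * h y hy
  -- Integrating the pointwise bound by `|K'| ⋆ |D|` gives `|c| ‖D‖₁ ≤ ‖K'‖₁ ‖D‖₁` for the damped
  -- functions, with `‖K'‖₁ < |c|`.
  set N : ℝ → ℝ := convolution (fun t => ‖K' t‖) (fun t => ‖damp r D t‖)
    (ContinuousLinearMap.mul ℝ ℝ) volume
  have hN0 : ∀ y, 0 ≤ N y := fun y => integral_nonneg fun t => by
    simp only [ContinuousLinearMap.mul_apply']; positivity
  have hle : ∀ y, ‖c‖ * ‖damp r D y‖ ≤ N y := fun y => by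
    by_cases hy : y ∈ Icc 0 b
    · rw [← norm_mul, hconv y hy, norm_neg]
      refine (norm_integral_le_integral_norm _).trans (le_of_eq ?_)
      simp only [norm_mul]; rfl
    · simpa [damp, hD0 y hy] using hN0 y
  have hint : ‖c‖ * ∫ y, ‖damp r D y‖ ≤ (∫ y, ‖K' y‖) * ∫ y, ‖damp r D y‖ := by
    rw [← integral_const_mul]
    refine (integral_mono (hfi.norm.const_mul _)
      (hri.norm.integrable_convolution _ hfi.norm) hle).trans (le_of_eq ?_)
    exact integral_convolution _ hri.norm hfi.norm
  have hz : ∫ y, ‖damp r D y‖ = 0 := by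
    have h0 : 0 ≤ ∫ y, ‖damp r D y‖ := integral_nonneg fun _ => norm_nonneg _
    nlinarith
  have hae : D =ᵐ[volume] 0 := by
    have := (integral_eq_zero_iff_of_nonneg (fun _ => norm_nonneg _) hfi.norm).1 hz
    filter_upwards [this] with y hy
    simpa [damp] using hy
  -- Vanishing almost everywhere makes `conv K D` vanish everywhere, and the equation upgrades this
  -- to `D y = 0` at every point.
  by_cases hy : y ∈ Icc 0 b
  · have h1 := h y hy
    have h2 : conv K D y = 0 := by
      rw [conv_swap]
      refine integral_eq_zero_of_ae ?_
      filter_upwards [hae] with t ht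
      simp [ht]
    rw [h2, zero_add] at h1
    exact (mul_eq_zero.1 h1).resolve_left hc
  · exact hD0 y hy

/-- Truncate the kernel at `b`, damp by some `r ≥ κ` large enough that `V` becomes bounded and the
kernel small, take the fixed point and undo the damping. -/
theorem IsVolterraKernel.exists_solution_Icc {K V : ℝ → ℂ} (hK : IsVolterraKernel K) {c : ℂ}
    (hc : c ≠ 0) (hV : AEStronglyMeasurable V) (hV0 : ∀ y < 0, V y = 0) {M κ : ℝ}
    (hM : ∀ y, ‖V y‖ ≤ M * Real.exp (κ * y)) (b : ℝ) :
    ∃ G : ℝ → ℂ, Continuous G ∧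
      ∀ y ≤ b, c * G y = conv K ((Ici 0).indicator fun y => V y - G y) y := by
  have hM0 : 0 ≤ M := by simpa using (norm_nonneg _).trans (hM 0)
  obtain ⟨r, hr, hri, hrc⟩ := hK.exists_damp_lt b (norm_pos_iff.2 hc) κ
  obtain ⟨G, hG, hGe⟩ := exists_fixedPoint_conv hri hrc
    (damp_aestronglyMeasurable (s := r) hV) (M := M) fun y => by
      rw [norm_damp, Complex.ofReal_re]
      rcases lt_or_ge y 0 with hy | hy
      · simpa [hV0 y hy] using hM0
      · calc Real.exp (-(r * y)) * ‖V y‖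
            ≤ Real.exp (-(r * y)) * (M * Real.exp (κ * y)) := by gcongr; exact hM y
          _ = M * Real.exp (-((r - κ) * y)) := by
              rw [mul_left_comm, ← Real.exp_add]; congr 2; ring
          _ ≤ M * 1 := by
              gcongr
              rw [Real.exp_le_one_iff]
              nlinarith
          _ = M := mul_one M
  have hind : ((Ici 0).indicator fun y => damp r V y - G y) =
      damp r ((Ici 0).indicator fun y => V y - damp (-r) G y) := by
    have hg : G = damp r (damp (-r) G) := by rw [damp_damp]; simp
    ext y
    by_cases hy : y ∈ Ici (0 : ℝ)
    · simp only [damp, indicator_of_mem hy, mul_sub, ← mul_assoc, ← Complex.exp_add]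
      simp
    · simp only [damp, indicator_of_notMem hy, mul_zero]
  refine ⟨damp (-r) G, ?_, fun y hy => ?_⟩
  · unfold damp; fun_prop
  · have h := hGe y
    rw [hind, conv_damp] at h
    simp only [damp] at h ⊢
    rw [conv_indicator_Iic (fun y hy => by simp [hy]) hy] at h
    rw [mul_left_comm, h, ← mul_assoc, ← Complex.exp_add]
    simp

/-- Existence for Volterra equations of the second kind on the half-line. -/
theorem IsVolterraKernel.exists_solution {K V : ℝ → ℂ} (hK : IsVolterraKernel K) {c : ℂ}
    (hc : c ≠ 0) (hV : AEStronglyMeasurable V) (hV0 : ∀ y < 0, V y = 0) {M κ : ℝ}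
    (hM : ∀ y, ‖V y‖ ≤ M * Real.exp (κ * y)) :
    ∃ U : ℝ → ℂ, AEStronglyMeasurable U ∧ (∀ y < 0, U y = 0) ∧
      (∀ b, ∃ C, 0 ≤ C ∧ ∀ y ∈ Icc 0 b, ‖U y‖ ≤ C) ∧ ContinuousOn (conv K U) (Ici 0) ∧
      ∀ y, conv K U y + c * U y = V y := by
  have hM0 : 0 ≤ M := by simpa using (norm_nonneg _).trans (hM 0)
  choose G hGc hG using fun n : ℕ => hK.exists_solution_Icc hc hV hV0 hM n
  set P : ℕ → ℝ → ℂ := fun n => (Ici 0).indicator fun y => V y - G n y with hP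
  have hP0 : ∀ n, ∀ y < 0, P n y = 0 := fun n y hy => by simp [hP, hy]
  have hPm : ∀ n, AEStronglyMeasurable (P n) := fun n =>
    (hV.sub (hGc n).aestronglyMeasurable).indicator measurableSet_Ici
  have hVb : ∀ b, ∀ y ∈ Icc 0 b, ‖V y‖ ≤ M * Real.exp (|κ| * b) := fun b y hy =>
    (hM y).trans (by
      have : κ * y ≤ |κ| * b := mul_le_mul (le_abs_self κ) hy.2 hy.1 (abs_nonneg κ)
      gcongr)
  have hGb : ∀ n b, ∃ C, 0 ≤ C ∧ ∀ y ∈ Icc (0 : ℝ) b, ‖G n y‖ ≤ C := fun n b => by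
    obtain ⟨C, hC⟩ := isCompact_Icc.exists_bound_of_continuousOn (s := Icc (0 : ℝ) b)
      (hGc n).continuousOn
    exact ⟨|C|, abs_nonneg C, fun y hy => (hC y hy).trans (le_abs_self C)⟩
  have hPb : ∀ n b, ∃ C, 0 ≤ C ∧ ∀ y ∈ Icc (0 : ℝ) b, ‖P n y‖ ≤ C := fun n b => by
    obtain ⟨C, hC0, hC⟩ := hGb n b
    refine ⟨M * Real.exp (|κ| * b) + C, by positivity, fun y hy => ?_⟩
    exact (norm_indicator_le_norm_self _ _).trans ((norm_sub_le _ _).trans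
      (add_le_add (hVb b y hy) (hC y hy)))
  have hPi : ∀ n y, Integrable fun t => K t * P n (y - t) := fun n y => by
    obtain ⟨C, hC0, hC⟩ := hPb n y
    exact hK.integrable_conv_integrand (hPm n) (hP0 n) hC0 hC
  -- On `[0, m]` the difference `G m - G n` solves the homogeneous equation, so it vanishes.
  have hcons : ∀ m n : ℕ, m ≤ n → ∀ y ∈ Icc (0 : ℝ) m, G m y = G n y := by
    intro m n hmn y hy
    have hD := hK.eq_zero_of_conv_eq hc (b := m)
      (D := (Icc (0 : ℝ) m).indicator fun y => G m y - G n y) ?_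
      (fun y hy => indicator_of_notMem hy _) ?_ y
    · rw [indicator_of_mem hy] at hD
      exact sub_eq_zero.1 hD
    · exact (((hGc m).sub (hGc n)).continuousOn.integrableOn_compact isCompact_Icc).integrable_indicator
        measurableSet_Icc
    · intro z hz
      have e : conv K ((Icc (0 : ℝ) m).indicator fun y => G m y - G n y) z =
          conv K (fun y => P n y - P m y) z := by
        refine conv_congr_Icc hK.eq_zero (fun y hy => ?_) (fun y hy => ?_) fun x hx => ?_
        · exact indicator_of_notMem (fun h => by linarith [h.1]) _
        · simp [hP0 n y hy, hP0 m y hy]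
        · have h1 : x ∈ Icc (0 : ℝ) m := ⟨hx.1, hx.2.trans hz.2⟩
          have h2 : x ∈ Ici (0 : ℝ) := hx.1
          simp only [hP, indicator_of_mem h1, indicator_of_mem h2]
          ring
      have e2 : conv K (fun y => P n y - P m y) z = conv K (P n) z - conv K (P m) z := by
        rw [conv, conv, conv, ← integral_sub (hPi n z) (hPi m z)]
        simp only [mul_sub]
      rw [e, e2, ← hG n z (hz.2.trans (by exact_mod_cast hmn)), ← hG m z hz.2,
        indicator_of_mem hz]
      ring
  set H : ℝ → ℂ := fun y => G ⌈y⌉₊ y with hH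
  have hHG : ∀ (n : ℕ) (y : ℝ), y ∈ Icc (0 : ℝ) n → H y = G n y := fun n y hy =>
    hcons _ _ (Nat.ceil_le.2 hy.2) y ⟨hy.1, Nat.le_ceil y⟩
  have hHc : ContinuousOn H (Ici 0) := by
    intro y hy
    -- The extra `1` lets a single `G n` cover a right neighbourhood of `y` when `y` is an integer.
    refine (hGc (⌈y⌉₊ + 1)).continuousWithinAt.congr_of_eventuallyEq ?_
      (hHG _ y ⟨hy, (Nat.le_ceil y).trans (by simp)⟩)
    have hlt : y < ((⌈y⌉₊ + 1 : ℕ) : ℝ) := (Nat.le_ceil y).trans_lt (by simp)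
    filter_upwards [self_mem_nhdsWithin, mem_nhdsWithin_of_mem_nhds (Iio_mem_nhds hlt)] with z h1 h2
    exact hHG _ z ⟨h1, le_of_lt h2⟩
  set U : ℝ → ℂ := fun y => c⁻¹ * (Ici 0).indicator (fun y => V y - H y) y with hU
  have hU0 : ∀ y < 0, U y = 0 := fun y hy => by simp [hU, hy]
  have hUP : ∀ (n : ℕ) (y : ℝ), y ∈ Icc (0 : ℝ) n → U y = c⁻¹ * P n y := fun n y hy => by
    have h2 : y ∈ Ici (0 : ℝ) := hy.1
    simp only [hU, hP, indicator_of_mem h2, hHG n y hy]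
  have hconv : ∀ y, 0 ≤ y → conv K U y = H y := fun y hy => by
    have hyn : y ∈ Icc (0 : ℝ) ⌈y⌉₊ := ⟨hy, Nat.le_ceil y⟩
    have e : conv K U y = conv K (fun z => c⁻¹ * P ⌈y⌉₊ z) y :=
      conv_congr_Icc hK.eq_zero hU0 (fun z hz => by simp [hP0 _ z hz])
        fun z hz => hUP _ z ⟨hz.1, hz.2.trans hyn.2⟩
    have e2 : conv K (fun z => c⁻¹ * P ⌈y⌉₊ z) y = c⁻¹ * conv K (P ⌈y⌉₊) y := by
      rw [conv, conv, ← integral_const_mul]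
      simp only [mul_left_comm]
    rw [e, e2, ← hG ⌈y⌉₊ y hyn.2, inv_mul_cancel_left₀ hc]
  refine ⟨U, ?_, hU0, fun b => ?_, hHc.congr fun y hy => hconv y hy, fun y => ?_⟩
  · refine AEStronglyMeasurable.const_mul ?_ _
    refine (aestronglyMeasurable_indicator_iff measurableSet_Ici).2 ?_
    exact hV.restrict.sub (hHc.aestronglyMeasurable measurableSet_Ici)
  · obtain ⟨C, hC0, hC⟩ := hPb ⌈b⌉₊ b
    refine ⟨‖c⁻¹‖ * C, by positivity, fun y hy => ?_⟩
    rw [hUP ⌈b⌉₊ y ⟨hy.1, hy.2.trans (Nat.le_ceil b)⟩, norm_mul]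
    exact mul_le_mul_of_nonneg_left (hC y hy) (norm_nonneg _)
  · rcases lt_or_ge y 0 with hy | hy
    · have : conv K U y = 0 := by
        rw [conv_congr_Icc (G := fun _ => 0) hK.eq_zero hU0 (fun _ _ => rfl)
          fun z hz => by linarith [hz.1, hz.2]]
        simp [conv]
      rw [this, hU0 y hy, hV0 y hy]
      simp
    · rw [hconv y hy]
      have h2 : y ∈ Ici (0 : ℝ) := hy
      simp only [hU, indicator_of_mem h2]
      rw [mul_inv_cancel_left₀ hc]
      ring

/-- Exponential bound for solutions of Volterra equations of the second kind. -/
theorem norm_conv_le_exp_of_solution {K U V : ℝ → ℂ} (hK0 : ∀ y ≤ 0, K y = 0) {c : ℂ} (hc : c ≠ 0)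
    (hU0 : ∀ y < 0, U y = 0) (hUc : ContinuousOn (conv K U) (Ici 0))
    (hUV : ∀ y, conv K U y + c * U y = V y) {r M : ℝ} (hK : Integrable (damp r K))
    (hKc : ∫ y, ‖damp r K y‖ ≤ ‖c‖ / 2) (hM : ∀ y, 0 ≤ y → ‖V y‖ ≤ M * Real.exp (r * y))
    {b : ℝ} (hb : 0 ≤ b) : ‖conv K U b‖ ≤ M * Real.exp (r * b) := by
  have hM0 : 0 ≤ M := by simpa using (norm_nonneg _).trans (hM 0 le_rfl)
  have hc' : 0 < ‖c‖ := norm_pos_iff.2 hc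
  have hcont : ContinuousOn (fun y => ‖damp r (conv K U) y‖) (Icc 0 b) := by
    unfold damp
    exact ((by fun_prop : Continuous fun y : ℝ => Complex.exp (-(r * y))).continuousOn.mul
      (hUc.mono Icc_subset_Ici_self)).norm
  -- Let `N` be the maximum of the damped `|K ⋆ U|` on `[0, b]`. The equation bounds the damped
  -- `|U|` by `(M + N) / |c|`; convolving with a kernel of norm at most `|c| / 2` gives `N ≤ (M + N)
  -- / 2`, that is `N ≤ M`.
  obtain ⟨y₀, hy₀, hmax⟩ := isCompact_Icc.exists_isMaxOn (nonempty_Icc.2 hb) hcont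
  set N := ‖damp r (conv K U) y₀‖ with hN
  have hN0 : 0 ≤ N := norm_nonneg _
  have hUb : ∀ z ∈ Icc 0 b, ‖damp r U z‖ ≤ (M + N) / ‖c‖ := fun z hz => by
    rw [le_div_iff₀ hc', mul_comm, ← norm_mul]
    have e : c * damp r U z = damp r V z - damp r (conv K U) z := by
      simp only [damp, ← hUV z]; ring
    rw [e]
    refine (norm_sub_le _ _).trans (add_le_add ?_ (hmax hz))
    rw [norm_damp, Complex.ofReal_re]
    calc Real.exp (-(r * z)) * ‖V z‖ ≤ Real.exp (-(r * z)) * (M * Real.exp (r * z)) := by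
          gcongr; exact hM z hz.1
      _ = M := by rw [mul_left_comm, ← Real.exp_add]; simp
  have hNle : N ≤ (M + N) / 2 := by
    have e : damp r (conv K U) y₀ = conv (damp r K) ((Icc 0 b).indicator (damp r U)) y₀ := by
      rw [← conv_damp]
      refine conv_congr_Icc (fun y hy => by simp [damp, hK0 y hy])
        (fun y hy => by simp [damp, hU0 y hy])
        (fun y hy => indicator_of_notMem (fun h => by linarith [h.1]) _) fun z hz => ?_
      rw [indicator_of_mem (show z ∈ Icc 0 b from ⟨hz.1, hz.2.trans hy₀.2⟩)]
    calc N = ‖conv (damp r K) ((Icc 0 b).indicator (damp r U)) y₀‖ := by rw [hN, e]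
      _ ≤ (∫ y, ‖damp r K y‖) * ((M + N) / ‖c‖) := by
          refine norm_conv_le hK (fun z => ?_) y₀
          by_cases hz : z ∈ Icc 0 b
          · rw [indicator_of_mem hz]; exact hUb z hz
          · rw [indicator_of_notMem hz, norm_zero]; positivity
      _ ≤ ‖c‖ / 2 * ((M + N) / ‖c‖) := by gcongr
      _ = (M + N) / 2 := by field_simp
  have h1 : ‖damp r (conv K U) b‖ ≤ M := le_trans (hmax (right_mem_Icc.2 hb)) (by linarith)
  rw [norm_damp, Complex.ofReal_re] at h1
  calc ‖conv K U b‖ = Real.exp (r * b) * (Real.exp (-(r * b)) * ‖conv K U b‖) := by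
        rw [← mul_assoc, ← Real.exp_add]; simp
    _ ≤ Real.exp (r * b) * M := by gcongr
    _ = _ := mul_comm _ _

end Volterra

/-! ### The kernel of the fractional integral and its Laplace transform -/

section Kernel

/-- The convolution kernel `y^(α-1) 𝒜(y^β)` of the fractional integral, on `(0, ∞)`. -/
def kern (A : ℂ → ℂ) (α β : ℂ) : ℝ → ℂ :=
  (Ioi 0).indicator fun y => (y : ℂ) ^ (α - 1) * A ((y : ℂ) ^ β)

theorem kern_of_pos (A : ℂ → ℂ) (α β : ℂ) {y : ℝ} (hy : 0 < y) :
    kern A α β y = (y : ℂ) ^ (α - 1) * A ((y : ℂ) ^ β) :=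
  indicator_of_mem (show y ∈ Ioi 0 from hy) _

theorem kern_of_nonpos (A : ℂ → ℂ) (α β : ℂ) {y : ℝ} (hy : y ≤ 0) : kern A α β y = 0 :=
  indicator_of_notMem (fun h : y ∈ Ioi 0 => (not_lt.2 hy) h) _

variable {a : ℕ → ℂ} {A : ℂ → ℂ} {α β : ℂ}

theorem measurable_of_hasSum_pow (hA : ∀ z : ℂ, HasSum (fun n => a n * z ^ n) (A z)) :
    Measurable A := by
  refine measurable_of_tendsto_metrizable (f := fun n z => ∑ i ∈ Finset.range n, a i * z ^ i)
    (fun n => by fun_prop) (tendsto_pi_nhds.2 fun z => (hA z).tendsto_sum_nat)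

theorem measurable_kern (hA : ∀ z : ℂ, HasSum (fun n => a n * z ^ n) (A z)) :
    Measurable (kern A α β) := by
  have := measurable_of_hasSum_pow hA
  exact (by fun_prop : Measurable fun y : ℝ => (y : ℂ) ^ (α - 1) * A ((y : ℂ) ^ β)).indicator
    measurableSet_Ioi

theorem norm_kern_le (hβ : 0 < β.re) (hA : ∀ z : ℂ, HasSum (fun n => a n * z ^ n) (A z))
    {y b : ℝ} (hy : 0 < y) (hyb : y ≤ b) :
    ‖kern A α β y‖ ≤ y ^ (α.re - 1) * ∑' n, ‖a n‖ * (b ^ β.re) ^ n := by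
  rw [kern_of_pos A α β hy, norm_mul, Complex.norm_cpow_eq_rpow_re_of_pos hy]
  refine mul_le_mul_of_nonneg_left ?_ (by positivity)
  have hb : 0 ≤ b := hy.le.trans hyb
  have hs : Summable fun n => ‖a n‖ * (b ^ β.re) ^ n := by
    have := (hA ((b ^ β.re : ℝ) : ℂ)).summable.norm
    refine this.congr fun n => ?_
    rw [norm_mul, norm_pow, Complex.norm_real, Real.norm_of_nonneg (by positivity)]
  rw [← (hA _).tsum_eq]
  refine tsum_of_norm_bounded hs.hasSum fun n => ?_
  rw [norm_mul, norm_pow, Complex.norm_cpow_eq_rpow_re_of_pos hy]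
  gcongr

theorem isVolterraKernel_kern (hα : 0 < α.re) (hβ : 0 < β.re)
    (hA : ∀ z : ℂ, HasSum (fun n => a n * z ^ n) (A z)) : IsVolterraKernel (kern A α β) := by
  refine ⟨fun y hy => kern_of_nonpos A α β hy, fun b => ?_⟩
  have hg : Integrable ((Ioc 0 b).indicator fun y : ℝ =>
      y ^ (α.re - 1) * ∑' n, ‖a n‖ * (b ^ β.re) ^ n) := by
    refine IntegrableOn.integrable_indicator ?_ measurableSet_Ioc
    refine Integrable.mul_const ?_ _
    rcases le_or_gt b 0 with hb | hb
    · simp [Ioc_eq_empty_of_le hb]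
    · exact (intervalIntegrable_iff_integrableOn_Ioc_of_le hb.le).1
        (intervalIntegral.intervalIntegrable_rpow' (by linarith))
  refine hg.mono' ((measurable_kern hA).indicator measurableSet_Iic).aestronglyMeasurable
    (Eventually.of_forall fun y => ?_)
  by_cases hyb : y ≤ b
  · rw [indicator_of_mem (show y ∈ Iic b from hyb)]
    rcases le_or_gt y 0 with hy | hy
    · rw [kern_of_nonpos A α β hy, indicator_of_notMem (fun h => not_lt.2 hy h.1), norm_zero]
    · rw [indicator_of_mem (show y ∈ Ioc 0 b from ⟨hy, hyb⟩)]
      exact norm_kern_le hβ hA hy hyb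
  · rw [indicator_of_notMem (show y ∉ Iic b from hyb), norm_zero]
    rw [indicator_of_notMem (fun h => hyb h.2)]

/-- By `exists_gamma_re_le` the terms are dominated by those of `𝒜_Γ` in absolute value at `t^(-Re
β) q`; for large `t` this point lies below `r / 2`, inside the disc of convergence. -/
theorem exists_summable_gamma_rpow (hα : 0 < α.re) (hβ : 0 < β.re)
    (h : ∃ r > (0 : ℝ), ∀ z : ℂ, ‖z‖ < r → Summable (gammaTerm a α β z)) :
    ∃ l > (0 : ℝ), ∀ t ≥ l, Summable fun n : ℕ =>
      ‖a n‖ * (Real.Gamma (β.re * n + α.re) * t ^ (-(β.re * n + α.re))) := by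
  obtain ⟨r, hr, hsum⟩ := h
  obtain ⟨E, hE, q, hq, hle⟩ := exists_gamma_re_le hα hβ
  have hlim : Tendsto (fun t : ℝ => t ^ (-β.re) * q) atTop (𝓝 0) := by
    simpa using (tendsto_rpow_neg_atTop hβ).mul_const q
  obtain ⟨l, hl⟩ := ((hlim.eventually (gt_mem_nhds (half_pos hr))).and
    (eventually_gt_atTop 0)).exists_forall_of_atTop
  refine ⟨l, (hl l le_rfl).2, fun t ht => ?_⟩
  obtain ⟨h1, ht0⟩ := hl t ht
  have hs := (hsum ((r / 2 : ℝ) : ℂ) (by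
    rw [Complex.norm_real, Real.norm_of_nonneg (by positivity)]; linarith)).norm.mul_left
      (E * t ^ (-α.re))
  refine hs.of_nonneg_of_le (fun n => ?_) fun n => ?_
  · have : 0 < Real.Gamma (β.re * n + α.re) := Real.Gamma_pos_of_pos (by positivity)
    positivity
  · have e : t ^ (-(β.re * n + α.re)) = t ^ (-α.re) * (t ^ (-β.re)) ^ n := by
      rw [← Real.rpow_natCast, ← Real.rpow_mul ht0.le, ← Real.rpow_add ht0]
      congr 1; ring
    rw [gammaTerm, norm_mul, norm_mul, norm_pow, Complex.norm_real,
      Real.norm_of_nonneg (by positivity : (0 : ℝ) ≤ r / 2), e]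
    calc ‖a n‖ * (Real.Gamma (β.re * n + α.re) * (t ^ (-α.re) * (t ^ (-β.re)) ^ n))
        ≤ ‖a n‖ * (‖Complex.Gamma (β * n + α)‖ * (E * q ^ n) *
          (t ^ (-α.re) * (t ^ (-β.re)) ^ n)) := by gcongr; exact hle n
      _ = E * t ^ (-α.re) * (‖a n‖ * ‖Complex.Gamma (β * n + α)‖ * (t ^ (-β.re) * q) ^ n) := by
          rw [mul_pow]; ring
      _ ≤ _ := by gcongr

theorem hasSum_damp_kern (hA : ∀ z : ℂ, HasSum (fun n => a n * z ^ n) (A z)) (s : ℂ) {y : ℝ}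
    (hy : 0 < y) : HasSum (fun n : ℕ =>
      a n * ((y : ℂ) ^ (β * n + α - 1) * Complex.exp (-(s * y)))) (damp s (kern A α β) y) := by
  rw [damp, kern_of_pos A α β hy, ← mul_assoc]
  have hy' : (y : ℂ) ≠ 0 := by exact_mod_cast hy.ne'
  convert! (hA ((y : ℂ) ^ β)).mul_left (Complex.exp (-(s * y)) * (y : ℂ) ^ (α - 1)) using 2 with n
  have e : (y : ℂ) ^ (β * n + α - 1) = (y : ℂ) ^ (α - 1) * ((y : ℂ) ^ β) ^ n := by
    rw [← Complex.cpow_mul_nat, ← Complex.cpow_add _ _ hy']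
    congr 1; ring
  rw [e]
  ring

theorem integrable_of_hasSum_of_summable_integral_norm {Ω : Type*} [MeasurableSpace Ω]
    {μ : Measure Ω} {F : ℕ → Ω → ℂ} {f : Ω → ℂ} (hF : ∀ n, Integrable (F n) μ)
    (hs : Summable fun n => ∫ x, ‖F n x‖ ∂μ) (hf : AEStronglyMeasurable f μ)
    (h : ∀ᵐ x ∂μ, HasSum (fun n => F n x) (f x)) : Integrable f μ := by
  refine ⟨hf, ?_⟩
  rw [hasFiniteIntegral_iff_enorm]
  calc ∫⁻ x, ‖f x‖ₑ ∂μ ≤ ∫⁻ x, ∑' n, ‖F n x‖ₑ ∂μ := by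
        refine lintegral_mono_ae ?_
        filter_upwards [h] with x hx
        rw [← hx.tsum_eq]
        exact enorm_tsum_le_tsum_enorm
    _ = ∑' n, ENNReal.ofReal (∫ x, ‖F n x‖ ∂μ) := by
        rw [lintegral_tsum fun n => (hF n).1.enorm]
        exact tsum_congr fun n => (ofReal_integral_norm_eq_lintegral_enorm (hF n)).symm
    _ < ⊤ := hs.tsum_ofReal_lt_top

/-- The Laplace transform of the kernel, term by term. -/
theorem laplace_kern (hα : 0 < α.re) (hβ : 0 < β.re)
    (hA : ∀ z : ℂ, HasSum (fun n => a n * z ^ n) (A z)) {s : ℂ} (hs : 0 < s.re)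
    (hsum : Summable fun n : ℕ =>
      ‖a n‖ * (Real.Gamma (β.re * n + α.re) * s.re ^ (-(β.re * n + α.re)))) :
    Integrable (damp s (kern A α β)) ∧ Summable (gammaTerm a α β (s ^ (-β))) ∧
      ∫ y, damp s (kern A α β) y = s ^ (-α) * gammaTransform a α β (s ^ (-β)) := by
  have hre : ∀ n : ℕ, (β * n + α).re = β.re * n + α.re := fun n => by simp
  have hpos : ∀ n : ℕ, 0 < (β * n + α).re := fun n => by rw [hre]; positivity
  set F : ℕ → ℝ → ℂ := fun n y => a n * ((y : ℂ) ^ (β * n + α - 1) * Complex.exp (-(s * y)))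
  have hFi : ∀ n, Integrable (F n) (volume.restrict (Ioi 0)) := fun n =>
    (integrableOn_cpow_mul_exp (hpos n) hs).const_mul (a n)
  have hFn : ∀ n, ∫ y in Ioi 0, ‖F n y‖ =
      ‖a n‖ * (Real.Gamma (β.re * n + α.re) * s.re ^ (-(β.re * n + α.re))) := fun n => by
    have e : ∫ y in Ioi 0, ‖F n y‖ = ∫ y in Ioi 0, ‖a n‖ *
        (y ^ (β.re * n + α.re - 1) * Real.exp (-(s.re * y))) :=
      setIntegral_congr_fun measurableSet_Ioi fun y hy => by
        simp only [F]
        rw [norm_mul, norm_cpow_mul_exp hy, hre]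
    rw [e, integral_const_mul, Real.integral_rpow_mul_exp_neg_mul_Ioi (by rw [← hre]; exact hpos n)
      hs, one_div, Real.inv_rpow hs.le, ← Real.rpow_neg hs.le, mul_comm (Real.Gamma _)]
  have hFs : Summable fun n => ∫ y in Ioi 0, ‖F n y‖ := by simpa only [hFn] using hsum
  have hae : ∀ᵐ y ∂volume.restrict (Ioi (0 : ℝ)),
      HasSum (fun n => F n y) (damp s (kern A α β) y) := by
    filter_upwards [self_mem_ae_restrict measurableSet_Ioi] with y hy
    exact hasSum_damp_kern hA s hy
  have hzero : ∀ y ∉ Ioi (0 : ℝ), damp s (kern A α β) y = 0 := fun y hy => by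
    simp [damp, kern_of_nonpos A α β (not_lt.1 hy)]
  have hint : Integrable (damp s (kern A α β)) (volume.restrict (Ioi 0)) :=
    integrable_of_hasSum_of_summable_integral_norm hFi hFs
      (damp_aestronglyMeasurable (measurable_kern hA).aestronglyMeasurable).restrict hae
  have hhs := hasSum_integral_of_summable_integral_norm hFi hFs
  have e1 : ∫ y in Ioi (0 : ℝ), ∑' n, F n y = ∫ y, damp s (kern A α β) y := by
    rw [← setIntegral_eq_integral_of_forall_compl_eq_zero hzero]
    refine integral_congr_ae ?_
    filter_upwards [hae] with y hy using hy.tsum_eq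
  have hs0 : s ≠ 0 := fun h => by simp [h] at hs
  have e2 : ∀ n, ∫ y in Ioi (0 : ℝ), F n y = s ^ (-α) * gammaTerm a α β (s ^ (-β)) n := fun n => by
    have e3 : s ^ (-(β * n + α)) = s ^ (-α) * (s ^ (-β)) ^ n := by
      rw [← Complex.cpow_mul_nat, ← Complex.cpow_add _ _ hs0]
      congr 1; ring
    simp only [F]
    rw [integral_const_mul, integral_cpow_mul_exp (hpos n) hs, gammaTerm, e3]
    ring
  simp only [e1, e2] at hhs
  have hne : s ^ (-α) ≠ 0 := by simp [Complex.cpow_eq_zero_iff, hs0]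
  have hsg : Summable (gammaTerm a α β (s ^ (-β))) := (summable_mul_left_iff hne).1 hhs.summable
  refine ⟨(integrableOn_iff_integrable_of_support_subset ?_).1 hint, hsg, ?_⟩
  · exact fun y hy => by_contra fun h => hy (hzero y h)
  · rw [← hhs.tsum_eq, tsum_mul_left, gammaTransform]

end Kernel

/-! ### Injectivity of the Laplace transform, and the substitution `y = φ x` -/

section ChangeOfVariables

open scoped FourierTransform ContDiff in
-- A smooth compactly supported test function is the Fourier transform of a Schwartz function, and
-- the multiplication formula moves the transform onto `F`.
theorem ae_eq_zero_of_fourier_eq_zero {F : ℝ → ℂ} (hF : Integrable F) (h : ∀ t : ℝ, 𝓕 F t = 0) :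
    ∀ᵐ y, F y = 0 := by
  refine ae_eq_zero_of_integral_contDiff_smul_eq_zero hF.locallyIntegrable fun g hg hgc => ?_
  have hgc' : HasCompactSupport fun x => (g x : ℂ) := hgc.comp_left Complex.ofReal_zero
  set G : SchwartzMap ℝ ℂ := hgc'.toSchwartzMap (Complex.ofRealCLM.contDiff.comp hg)
  have hG : ∀ x, 𝓕 ((𝓕⁻ G : SchwartzMap ℝ ℂ) : ℝ → ℂ) x = g x := fun x => by
    rw [← SchwartzMap.fourier_coe, FourierTransform.fourier_fourierInv_eq]; rfl
  have key := VectorFourier.integral_fourierIntegral_smul_eq_flip (μ := volume) (ν := volume)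
    (L := innerₗ ℝ) (e := Real.fourierChar) Real.continuous_fourierChar continuous_inner
    (𝓕⁻ G : SchwartzMap ℝ ℂ).integrable hF
  have e : ∫ x, g x • F x = ∫ x, 𝓕 ((𝓕⁻ G : SchwartzMap ℝ ℂ) : ℝ → ℂ) x • F x :=
    integral_congr_ae (Eventually.of_forall fun x => by simp only [hG]; simp)
  rw [e]
  refine Eq.trans key ?_
  refine integral_eq_zero_of_ae (Eventually.of_forall fun x => ?_)
  have h2 : VectorFourier.fourierIntegral Real.fourierChar volume (innerₗ ℝ).flip F x = 0 := by
    rw [flip_innerₗ]; exact h x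
  change _ • VectorFourier.fourierIntegral Real.fourierChar volume (innerₗ ℝ).flip F x = 0
  rw [h2, smul_zero]

/-- Injectivity of the two-sided Laplace transform on a half-plane. -/
theorem ae_eq_of_integral_damp_eq {F F' : ℝ → ℂ} {σ : ℝ}
    (hF : ∀ s : ℂ, σ < s.re → Integrable (damp s F))
    (hF' : ∀ s : ℂ, σ < s.re → Integrable (damp s F'))
    (h : ∀ s : ℂ, σ < s.re → ∫ y, damp s F y = ∫ y, damp s F' y) : F =ᵐ[volume] F' := by
  have hσ : σ < ((σ + 1 : ℝ) : ℂ).re := by simp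
  set D : ℝ → ℂ := fun y => damp (σ + 1 : ℝ) F y - damp (σ + 1 : ℝ) F' y
  have hD : Integrable D := (hF _ hσ).sub (hF' _ hσ)
  have h0 := ae_eq_zero_of_fourier_eq_zero hD fun t => by
    rw [Real.fourier_real_eq_integral_exp_smul]
    -- The Fourier transform of `D` at `t` is the Laplace difference at this point of the line `Re s
    -- = σ + 1`.
    set s : ℂ := (σ + 1 : ℝ) + (2 * Real.pi * t : ℝ) * Complex.I with hs
    have hsre : σ < s.re := by
      rw [hs, Complex.add_re, Complex.re_ofReal_mul, Complex.I_re, mul_zero, add_zero]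
      exact hσ
    have e : ∀ (E : ℝ → ℂ) (y : ℝ), Complex.exp (((-2 * Real.pi * y * t : ℝ) : ℂ) * Complex.I) *
        damp (σ + 1 : ℝ) E y = damp s E y := fun E y => by
      simp only [damp, ← mul_assoc, ← Complex.exp_add, hs]
      congr 2
      push_cast
      ring
    simp only [smul_eq_mul, D, mul_sub, e]
    rw [integral_sub (hF s hsre) (hF' s hsre), h s hsre, sub_self]
  filter_upwards [h0] with y hy
  simp only [D, damp, ← mul_sub] at hy
  exact sub_eq_zero.1 ((mul_eq_zero.1 hy).resolve_left (Complex.exp_ne_zero _))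

variable {φ : ℝ → ℝ}

theorem IsWeight.hasDerivWithinAt (hφ : IsWeight φ) {x : ℝ} (hx : 0 ≤ x) :
    HasDerivWithinAt φ (dphi φ x) (Ici 0) x :=
  (hφ.contDiffOn.differentiableOn one_ne_zero x hx).hasDerivWithinAt

theorem IsWeight.continuousOn (hφ : IsWeight φ) : ContinuousOn φ (Ici 0) :=
  hφ.contDiffOn.continuousOn

theorem IsWeight.continuousOn_dphi (hφ : IsWeight φ) : ContinuousOn (dphi φ) (Ici 0) :=
  hφ.contDiffOn.continuousOn_derivWithin (uniqueDiffOn_Ici 0) le_rfl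

theorem IsWeight.dphi_nonneg (hφ : IsWeight φ) (x : ℝ) : 0 ≤ dphi φ x :=
  hφ.monotoneOn.derivWithin_nonneg

theorem IsWeight.nonneg (hφ : IsWeight φ) {x : ℝ} (hx : 0 ≤ x) : 0 ≤ φ x := by
  rw [← hφ.map_zero]
  exact hφ.monotoneOn self_mem_Ici hx hx

theorem IsWeight.image_Icc (hφ : IsWeight φ) {x : ℝ} (hx : 0 ≤ x) :
    φ '' Icc 0 x = Icc 0 (φ x) := by
  refine Subset.antisymm ?_ ?_
  · rintro _ ⟨t, ht, rfl⟩
    exact ⟨hφ.nonneg ht.1, hφ.monotoneOn ht.1 hx ht.2⟩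
  · have := intermediate_value_Icc hx (hφ.continuousOn.mono Icc_subset_Ici_self)
    rwa [hφ.map_zero] at this

theorem IsWeight.image_Ici_subset (hφ : IsWeight φ) : φ '' Ici 0 ⊆ Ici 0 := by
  rintro _ ⟨t, ht, rfl⟩
  exact hφ.nonneg ht

theorem IsWeight.image_Ici (hφ : IsWeight φ) (h : Tendsto φ atTop atTop) :
    φ '' Ici 0 = Ici 0 := by
  refine hφ.image_Ici_subset.antisymm fun y hy => ?_
  obtain ⟨x, hx, hx0⟩ := ((h.eventually (eventually_ge_atTop y)).and
    (eventually_ge_atTop 0)).exists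
  have : y ∈ φ '' Icc 0 x := by rw [hφ.image_Icc hx0]; exact ⟨hy, hx⟩
  exact image_mono Icc_subset_Ici_self this

/-- Monotonicity forces `φ` to be constant between `t` and `t'`. Thus `φ` fails to be injective only
where the weight `φ'` vanishes. -/
theorem IsWeight.dphi_eq_zero (hφ : IsWeight φ) {t t' : ℝ} (ht : 0 ≤ t) (ht' : 0 ≤ t')
    (hne : t ≠ t') (h : φ t = φ t') : dphi φ t = 0 := by
  have hsub : uIcc t t' ⊆ Ici 0 := fun z hz => (le_min ht ht').trans hz.1
  have h1 : HasDerivWithinAt φ (dphi φ t) (uIcc t t') t := (hφ.hasDerivWithinAt ht).mono hsub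
  have hconst : ∀ z ∈ uIcc t t', φ z = φ t := fun z hz => by
    have hz0 := hsub hz
    rcases le_total t t' with hle | hle
    · rw [uIcc_of_le hle] at hz
      exact le_antisymm (h ▸ hφ.monotoneOn hz0 ht' hz.2) (hφ.monotoneOn ht hz0 hz.1)
    · rw [uIcc_of_ge hle] at hz
      exact le_antisymm (hφ.monotoneOn hz0 ht hz.2) (h ▸ hφ.monotoneOn ht' hz0 hz.1)
  have h2 : HasDerivWithinAt φ 0 (uIcc t t') t :=
    (hasDerivWithinAt_const t _ (φ t)).congr hconst rfl
  refine UniqueDiffWithinAt.eq_deriv _ ?_ h1 h2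
  exact uniqueDiffOn_Icc (min_lt_max.2 hne) t left_mem_uIcc

theorem IsWeight.integrableOn_image_iff (hφ : IsWeight φ) {S : Set ℝ} (hS : MeasurableSet S)
    (hS0 : S ⊆ Ici 0) (H : ℝ → ℂ) :
    IntegrableOn H (φ '' S) ↔ IntegrableOn (fun t => (dphi φ t : ℂ) * H (φ t)) S := by
  simpa using integrableOn_image_iff_integrableOn_deriv_smul_of_monotoneOn hS
    (fun x hx => (hφ.hasDerivWithinAt (hS0 hx)).mono hS0) (hφ.monotoneOn.mono hS0) H

theorem IsWeight.integral_image (hφ : IsWeight φ) {S : Set ℝ} (hS : MeasurableSet S)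
    (hS0 : S ⊆ Ici 0) (H : ℝ → ℂ) :
    ∫ y in φ '' S, H y = ∫ t in S, (dphi φ t : ℂ) * H (φ t) := by
  simpa using integral_image_eq_integral_deriv_smul_of_monotoneOn hS
    (fun x hx => (hφ.hasDerivWithinAt (hS0 hx)).mono hS0) (hφ.monotoneOn.mono hS0) H

/-- The function `F` on the range of `φ` with `F ∘ φ = f` wherever `φ' ≠ 0`, extended by zero. -/
def pull (φ : ℝ → ℝ) (f : ℝ → ℂ) : ℝ → ℂ :=
  (φ '' Ici 0).indicator fun y => f (Function.invFunOn φ (Ici 0) y)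

theorem pull_of_notMem (f : ℝ → ℂ) {y : ℝ} (hy : y ∉ φ '' Ici 0) : pull φ f y = 0 :=
  indicator_of_notMem hy _

theorem IsWeight.pull_of_neg (hφ : IsWeight φ) (f : ℝ → ℂ) {y : ℝ} (hy : y < 0) :
    pull φ f y = 0 :=
  pull_of_notMem f fun h => (not_le.2 hy) (hφ.image_Ici_subset h)

theorem exists_pull_eq {y : ℝ} (hy : y ∈ φ '' Ici 0) :
    ∃ x, 0 ≤ x ∧ φ x = y ∧ ∀ f : ℝ → ℂ, pull φ f y = f x :=
  ⟨Function.invFunOn φ (Ici 0) y, Function.invFunOn_mem hy, Function.invFunOn_eq hy,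
    fun _ => indicator_of_mem hy _⟩

theorem IsWeight.pull_apply (hφ : IsWeight φ) {t : ℝ} (ht : 0 ≤ t) :
    dphi φ t = 0 ∨ ∀ f : ℝ → ℂ, pull φ f (φ t) = f t := by
  obtain ⟨x, hx, hxt, hf⟩ := exists_pull_eq (mem_image_of_mem φ ht)
  rcases eq_or_ne t x with rfl | hne
  · exact Or.inr hf
  · exact Or.inl (hφ.dphi_eq_zero ht hx hne hxt.symm)

theorem IsWeight.dphi_mul_pull (hφ : IsWeight φ) (H : ℝ → ℂ) (f : ℝ → ℂ) {t : ℝ} (ht : 0 ≤ t) :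
    (dphi φ t : ℂ) * (H (φ t) * pull φ f (φ t)) = (dphi φ t : ℂ) * (H (φ t) * f t) := by
  rcases hφ.pull_apply ht with h | h
  · simp [h]
  · rw [h f]

/-- The two sides can differ only where `φ t = φ x`, because `kern` is set to `0` at `0`. For `t <
x` this forces `φ' t = 0`, and `t = x` is a null set. -/
theorem IsWeight.integrand_ae_eq (hφ : IsWeight φ) (A : ℂ → ℂ) (α β : ℂ) (f : ℝ → ℂ) {x : ℝ}
    (hx : 0 ≤ x) : integrand A φ α β f x =ᵐ[volume.restrict (Icc 0 x)]
      fun t => (dphi φ t : ℂ) * (kern A α β (φ x - φ t) * pull φ f (φ t)) := by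
  have hne : ∀ᵐ t ∂volume.restrict (Icc 0 x), t ≠ x :=
    ae_restrict_of_ae (by simp [ae_iff])
  filter_upwards [self_mem_ae_restrict measurableSet_Icc, hne] with t ht htx
  rw [hφ.dphi_mul_pull (fun y => kern A α β (φ x - y)) f ht.1, integrand]
  rcases (hφ.monotoneOn ht.1 hx ht.2).lt_or_eq with h | h
  · rw [kern_of_pos A α β (sub_pos.2 h)]
    ring
  · simp [hφ.dphi_eq_zero ht.1 hx htx h]

theorem IsWeight.intervalIntegrable_integrand_iff (hφ : IsWeight φ) (A : ℂ → ℂ) (α β : ℂ)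
    (f : ℝ → ℂ) {x : ℝ} (hx : 0 ≤ x) :
    IntervalIntegrable (integrand A φ α β f x) volume 0 x ↔
      Integrable fun t => kern A α β t * pull φ f (φ x - t) := by
  have h2 : (Integrable fun t => kern A α β t * pull φ f (φ x - t)) ↔
      Integrable fun y => kern A α β (φ x - y) * pull φ f y := by
    rw [← integrable_comp_sub_left _ (φ x)]
    simp
  rw [intervalIntegrable_iff_integrableOn_Icc_of_le hx, h2, IntegrableOn,
    integrable_congr (hφ.integrand_ae_eq A α β f hx), ← IntegrableOn,
    ← hφ.integrableOn_image_iff measurableSet_Icc Icc_subset_Ici_self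
      (fun y => kern A α β (φ x - y) * pull φ f y), hφ.image_Icc hx]
  refine integrableOn_iff_integrable_of_support_subset fun y hy => ?_
  by_contra h
  apply hy
  rcases lt_or_ge y 0 with h0 | h0
  · simp [hφ.pull_of_neg f h0]
  · have : φ x < y := not_le.1 fun h1 => h ⟨h0, h1⟩
    simp [kern_of_nonpos A α β (sub_nonpos.2 this.le)]

theorem IsWeight.fracIntegral_eq (hφ : IsWeight φ) (A : ℂ → ℂ) (α β : ℂ) (f : ℝ → ℂ) {x : ℝ}
    (hx : 0 ≤ x) : fracIntegral A φ α β f x = conv (kern A α β) (pull φ f) (φ x) := by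
  rw [fracIntegral, intervalIntegral.integral_of_le hx, ← integral_Icc_eq_integral_Ioc,
    integral_congr_ae (hφ.integrand_ae_eq A α β f hx),
    ← hφ.integral_image measurableSet_Icc Icc_subset_Ici_self
      (fun y => kern A α β (φ x - y) * pull φ f y), hφ.image_Icc hx, conv_swap]
  refine setIntegral_eq_integral_of_forall_compl_eq_zero fun y h => ?_
  rcases lt_or_ge y 0 with h0 | h0
  · simp [hφ.pull_of_neg f h0]
  · have : φ x < y := not_le.1 fun h1 => h ⟨h0, h1⟩
    simp [kern_of_nonpos A α β (sub_nonpos.2 this.le)]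

theorem IsWeight.laplaceIntegrand_eqOn (hφ : IsWeight φ) (f : ℝ → ℂ) (s : ℂ) :
    EqOn (laplaceIntegrand φ f s) (fun t => (dphi φ t : ℂ) * damp s (pull φ f) (φ t))
      (Ici 0) := fun t ht => by
  simp only [damp]
  rw [hφ.dphi_mul_pull (fun y => Complex.exp (-(s * y))) f ht, laplaceIntegrand, neg_mul]
  ring

theorem damp_pull_of_notMem (f : ℝ → ℂ) (s : ℂ) {y : ℝ} (hy : y ∉ φ '' Ici 0) :
    damp s (pull φ f) y = 0 := by
  rw [damp, pull_of_notMem f hy, mul_zero]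

theorem IsWeight.laplaceConverges_iff (hφ : IsWeight φ) (f : ℝ → ℂ) (s : ℂ) :
    LaplaceConverges φ f s ↔ Integrable (damp s (pull φ f)) := by
  rw [LaplaceConverges, ← integrableOn_Ici_iff_integrableOn_Ioi,
    integrableOn_congr_fun (hφ.laplaceIntegrand_eqOn f s) measurableSet_Ici,
    ← hφ.integrableOn_image_iff measurableSet_Ici subset_rfl]
  exact integrableOn_iff_integrable_of_support_subset fun y hy =>
    by_contra fun h => hy (damp_pull_of_notMem f s h)

theorem IsWeight.laplace_eq (hφ : IsWeight φ) (f : ℝ → ℂ) (s : ℂ) :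
    laplace φ f s = ∫ y, damp s (pull φ f) y := by
  rw [laplace, ← integral_Ici_eq_integral_Ioi,
    setIntegral_congr_fun measurableSet_Ici (hφ.laplaceIntegrand_eqOn f s),
    ← hφ.integral_image measurableSet_Ici subset_rfl]
  exact setIntegral_eq_integral_of_forall_compl_eq_zero fun y h => damp_pull_of_notMem f s h

theorem IsWeight.integrableOn_dphi_mul_iff (hφ : IsWeight φ) (f : ℝ → ℂ) {b : ℝ} (hb : 0 ≤ b) :
    IntegrableOn (fun x => (dphi φ x : ℂ) * f x) (Icc 0 b) ↔
      IntegrableOn (pull φ f) (Icc 0 (φ b)) := by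
  rw [← hφ.image_Icc hb, hφ.integrableOn_image_iff measurableSet_Icc Icc_subset_Ici_self]
  refine integrableOn_congr_fun (fun t ht => ?_) measurableSet_Icc
  simpa using (hφ.dphi_mul_pull (fun _ => 1) f ht.1).symm

/-- By the change of variables, the preimage under `φ` of a null set meets `φ' ≠ 0` in a null set.
-/
theorem IsWeight.ae_eq_of_pull_ae_eq (hφ : IsWeight φ) {f g : ℝ → ℂ}
    (h : pull φ f =ᵐ[volume] pull φ g) :
    ∀ᵐ x ∂volume.restrict (Ici (0 : ℝ)), dphi φ x ≠ 0 → f x = g x := by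
  obtain ⟨N, hN, hNm, hN0⟩ := exists_measurable_superset_of_null (ae_iff.1 h)
  have h1 := lintegral_image_eq_lintegral_deriv_mul_of_monotoneOn (measurableSet_Ici (a := (0 : ℝ)))
    (fun x hx => hφ.hasDerivWithinAt hx) hφ.monotoneOn (N.indicator 1)
  have h2 : ∫⁻ y in φ '' Ici 0, N.indicator 1 y = 0 := by
    refine le_antisymm ((setLIntegral_le_lintegral _ _).trans ?_) zero_le
    rw [lintegral_indicator_one hNm, hN0]
  rw [h2] at h1
  have hm : AEMeasurable (fun x => ENNReal.ofReal (dphi φ x) * N.indicator 1 (φ x))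
      (volume.restrict (Ici (0 : ℝ))) := by
    refine AEMeasurable.mul ?_ ?_
    · exact (hφ.continuousOn_dphi.aemeasurable measurableSet_Ici).ennreal_ofReal
    · exact (measurable_one.indicator hNm).comp_aemeasurable
        (hφ.continuousOn.aemeasurable measurableSet_Ici)
  have h3 := (lintegral_eq_zero_iff' hm).1 h1.symm
  filter_upwards [h3, self_mem_ae_restrict measurableSet_Ici] with x hx hx0 hd
  have hpos : 0 < dphi φ x := (hφ.dphi_nonneg x).lt_of_ne' hd
  have hxN : φ x ∉ N := fun hmem => by
    simp [hmem, hpos.not_ge] at hx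
  have hp := (hφ.pull_apply hx0).resolve_left hd
  rw [← hp f, ← hp g]
  exact by_contra fun hne => hxN (hN hne)

end ChangeOfVariables

/-! ### Piecewise continuous data and transfer of solutions -/

section Solutions

/-- Around each point the one-sided limits bound `f` on either side; compactness of `[0, T]` joins
the local bounds. -/
theorem PiecewiseContinuous.exists_bound {f : ℝ → ℂ} (hf : PiecewiseContinuous f) (T : ℝ) :
    ∃ C, 0 ≤ C ∧ ∀ x ∈ Icc 0 T, ‖f x‖ ≤ C := by
  refine isCompact_Icc.induction_on (p := fun S => ∃ C, 0 ≤ C ∧ ∀ x ∈ S, ‖f x‖ ≤ C)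
    ⟨0, le_rfl, by simp⟩ (fun S S' h ⟨C, hC, hb⟩ => ⟨C, hC, fun x hx => hb x (h hx)⟩) ?_ ?_
  · rintro S S' ⟨C, hC, hb⟩ ⟨C', hC', hb'⟩
    refine ⟨max C C', hC.trans (le_max_left _ _), fun x hx => ?_⟩
    rcases hx with hx | hx
    · exact (hb x hx).trans (le_max_left _ _)
    · exact (hb' x hx).trans (le_max_right _ _)
  · intro x hx
    obtain ⟨l, hl⟩ := hf.right_lim x hx.1
    have hr : ∀ᶠ z in 𝓝[>] x, ‖f z‖ ≤ ‖l‖ + 1 :=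
      (hl.norm.eventually (gt_mem_nhds (lt_add_one _))).mono fun _ h => le_of_lt h
    obtain ⟨C, hC⟩ : ∃ C : ℝ, ∀ᶠ z in 𝓝[Icc 0 T ∩ Iio x] x, ‖f z‖ ≤ C := by
      rcases hx.1.eq_or_lt with h0 | h0
      · refine ⟨0, ?_⟩
        have : Icc 0 T ∩ Iio x = ∅ := by
          rw [← h0]; exact eq_empty_of_forall_notMem fun z hz => not_lt.2 hz.1.1 hz.2
        simp [this]
      · obtain ⟨l', hl'⟩ := hf.left_lim x h0
        refine ⟨‖l'‖ + 1, Filter.Eventually.filter_mono (nhdsWithin_mono _ inter_subset_right) ?_⟩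
        exact (hl'.norm.eventually (gt_mem_nhds (lt_add_one _))).mono fun _ h => le_of_lt h
    refine ⟨{z | z ∈ Icc 0 T → ‖f z‖ ≤ max (max C (‖l‖ + 1)) ‖f x‖} ∩ Icc 0 T, ?_,
      max (max C (‖l‖ + 1)) ‖f x‖, (norm_nonneg _).trans (le_max_right _ _), fun z hz => hz.1 hz.2⟩
    refine inter_mem ?_ self_mem_nhdsWithin
    rw [eventually_nhdsWithin_iff] at hC hr
    refine mem_nhdsWithin_of_mem_nhds ?_
    filter_upwards [hC, hr] with z h1 h2 hz
    rcases lt_trichotomy z x with h | h | h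
    · exact (h1 ⟨hz, h⟩).trans ((le_max_left _ _).trans (le_max_left _ _))
    · rw [h]; exact le_max_right _ _
    · exact (h2 h).trans ((le_max_right _ _).trans (le_max_left _ _))

theorem PiecewiseContinuous.aestronglyMeasurable {f : ℝ → ℂ} (hf : PiecewiseContinuous f) :
    AEStronglyMeasurable f (volume.restrict (Ici 0)) := by
  set D : Set ℝ := ⋃ n : ℕ, {x ∈ Icc (0 : ℝ) n | ¬ ContinuousWithinAt f (Ici 0) x} with hD
  have hDc : D.Countable := countable_iUnion fun n => (hf.finite_disc n).countable
  have hcont : ContinuousOn f (Ici 0 \ D) := by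
    intro x hx
    by_contra hc
    refine hx.2 (mem_iUnion.2 ⟨⌈x⌉₊, ⟨hx.1, Nat.le_ceil x⟩, fun h => hc (h.mono sdiff_subset)⟩)
  have e : volume.restrict (Ici (0 : ℝ)) = volume.restrict (Ici 0 \ D) :=
    Measure.restrict_congr_set (sdiff_null_ae_eq_self (hDc.measure_zero volume)).symm
  rw [e]
  exact hcont.aestronglyMeasurable (measurableSet_Ici.diff hDc.measurableSet)

theorem PiecewiseContinuous.const_mul_sub {f g : ℝ → ℂ} (hf : PiecewiseContinuous f)
    (hg : ContinuousOn g (Ici 0)) (c : ℂ) : PiecewiseContinuous fun x => c * (f x - g x) := by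
  refine ⟨fun T => (hf.finite_disc T).subset ?_, fun x hx => ?_, fun x hx => ?_⟩
  · rintro x ⟨hx, h⟩
    exact ⟨hx, fun hc => h (continuousWithinAt_const.mul (hc.sub (hg x hx.1)))⟩
  · obtain ⟨l, hl⟩ := hf.right_lim x hx
    have h1 : Tendsto g (𝓝[>] x) (𝓝 (g x)) :=
      (hg x hx).mono_left (nhdsWithin_mono _ fun z hz => hx.trans (le_of_lt hz))
    exact ⟨_, (hl.sub h1).const_mul c⟩
  · obtain ⟨l, hl⟩ := hf.left_lim x hx
    have h1 : Tendsto g (𝓝[<] x) (𝓝 (g x)) :=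
      ((hg x hx.le).continuousAt (Ici_mem_nhds hx)).tendsto.mono_left nhdsWithin_le_nhds
    exact ⟨_, (hl.sub h1).const_mul c⟩

variable {φ : ℝ → ℝ}

theorem exists_exp_bound (hφ : IsWeight φ) {f : ℝ → ℂ} (hf : PiecewiseContinuous f)
    (hf' : ExpOrder φ f) :
    ∃ M κ : ℝ, 0 < M ∧ 0 < κ ∧ ∀ x, 0 ≤ x → ‖f x‖ ≤ M * Real.exp (κ * φ x) := by
  obtain ⟨κ, hκ, M, hM, X, hX, h⟩ := hf'
  obtain ⟨C, hC, hb⟩ := hf.exists_bound X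
  refine ⟨M + C, κ, by positivity, hκ, fun x hx => ?_⟩
  have h1 : 1 ≤ Real.exp (κ * φ x) := Real.one_le_exp (mul_nonneg hκ.le (hφ.nonneg hx))
  rcases le_or_gt x X with hxX | hxX
  · have := hb x ⟨hx, hxX⟩
    nlinarith
  · have := h x hxX
    nlinarith

/-- The majorant `φ' e^(-(Re s - κ) φ)` is the substitution `y = φ x` applied to an integrable
exponential. -/
theorem laplaceConverges_of_exp_bound (hφ : IsWeight φ) {f : ℝ → ℂ}
    (hm : AEStronglyMeasurable f (volume.restrict (Ici 0))) {M κ : ℝ}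
    (h : ∀ x, 0 ≤ x → ‖f x‖ ≤ M * Real.exp (κ * φ x)) {s : ℂ} (hs : κ < s.re) :
    LaplaceConverges φ f s := by
  have h1 : IntegrableOn (fun y : ℝ => ((M * Real.exp (-((s.re - κ) * y)) : ℝ) : ℂ)) (Ici 0) := by
    refine Integrable.ofReal (Integrable.const_mul ?_ M)
    have := exp_neg_integrableOn_Ioi 0 (sub_pos.2 hs)
    rw [← IntegrableOn, integrableOn_Ici_iff_integrableOn_Ioi]
    simpa only [neg_mul] using this
  have h2 := ((hφ.integrableOn_image_iff measurableSet_Ici subset_rfl _).1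
    (h1.mono_set hφ.image_Ici_subset)).norm
  rw [LaplaceConverges, ← integrableOn_Ici_iff_integrableOn_Ioi]
  refine h2.mono' ?_ ?_
  · have hc : ContinuousOn (fun x => Complex.exp (-s * (φ x : ℂ)) * (dphi φ x : ℂ)) (Ici 0) :=
      ((continuousOn_const.mul (Complex.continuous_ofReal.comp_continuousOn
        hφ.continuousOn)).cexp).mul (Complex.continuous_ofReal.comp_continuousOn hφ.continuousOn_dphi)
    exact (hc.aestronglyMeasurable measurableSet_Ici).mul hm
  · filter_upwards [self_mem_ae_restrict measurableSet_Ici] with x hx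
    have hM : 0 ≤ M := nonneg_of_mul_nonneg_left ((norm_nonneg _).trans (h x hx)) (Real.exp_pos _)
    rw [laplaceIntegrand, norm_mul, norm_mul, norm_mul, Complex.norm_exp, Complex.norm_real,
      Complex.norm_real, Real.norm_of_nonneg (hφ.dphi_nonneg x),
      Real.norm_of_nonneg (by positivity)]
    have e : (-s * (φ x : ℂ)).re = -(s.re * φ x) := by simp
    have e2 : Real.exp (-((s.re - κ) * φ x)) = Real.exp (-(s.re * φ x)) * Real.exp (κ * φ x) := by
      rw [← Real.exp_add]; congr 1; ring
    rw [e, e2, mul_comm (Real.exp _) (dphi φ x), mul_assoc]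
    refine mul_le_mul_of_nonneg_left ?_ (hφ.dphi_nonneg x)
    calc _ ≤ Real.exp (-(s.re * φ x)) * (M * Real.exp (κ * φ x)) := by gcongr; exact h x hx
      _ = _ := by ring

/-- `pull` involves an arbitrary choice of preimages, so its measurability is read off from the
change of variables, by undoing the damping. -/
theorem aestronglyMeasurable_pull_of_laplaceConverges (hφ : IsWeight φ) {f : ℝ → ℂ} {s : ℂ}
    (h : LaplaceConverges φ f s) : AEStronglyMeasurable (pull φ f) := by
  have h1 := damp_aestronglyMeasurable (s := -s) ((hφ.laplaceConverges_iff f s).1 h).1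
  rw [damp_damp] at h1
  simpa using h1

theorem norm_pull_le {f : ℝ → ℂ} {M κ : ℝ} (hM : 0 ≤ M)
    (h : ∀ x, 0 ≤ x → ‖f x‖ ≤ M * Real.exp (κ * φ x)) (y : ℝ) :
    ‖pull φ f y‖ ≤ M * Real.exp (κ * y) := by
  by_cases hy : y ∈ φ '' Ici 0
  · obtain ⟨x, hx, rfl, hf⟩ := exists_pull_eq hy
    rw [hf]; exact h x hx
  · rw [pull_of_notMem f hy, norm_zero]; positivity

section Solution

variable {A : ℂ → ℂ} {α β : ℂ} {c : ℝ} {v w w' : ℝ → ℂ}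

theorem IsSolution.conv_pull (hφ : IsWeight φ) (hw : IsSolution A φ α β c v w) {y : ℝ}
    (hy : y ∈ φ '' Ici 0) :
    conv (kern A α β) (pull φ w) y + c * pull φ w y = pull φ v y := by
  obtain ⟨x, hx, rfl, hf⟩ := exists_pull_eq hy
  rw [hf, hf, ← hφ.fracIntegral_eq A α β w hx]
  exact hw.equation x hx

theorem IsSolution.eqOn (hφ : IsWeight φ) (hK : IsVolterraKernel (kern A α β)) (hc : c ≠ 0)
    (hw : IsSolution A φ α β c v w) (hw' : IsSolution A φ α β c v w') : EqOn w w' (Ici 0) := by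
  intro b hb
  have hc' : (c : ℂ) ≠ 0 := by exact_mod_cast hc
  -- `locL1` speaks of `b > 0` only; at `0` the initial value decides.
  rcases (show 0 ≤ b from hb).eq_or_lt with rfl | hb0
  · rw [hw.initial, hw'.initial]
  set D : ℝ → ℂ := (Icc 0 (φ b)).indicator fun y => pull φ w y - pull φ w' y with hD
  have hmem : ∀ y ∈ Icc 0 (φ b), y ∈ φ '' Ici 0 := fun y hy => by
    rw [← hφ.image_Icc hb] at hy
    exact image_mono Icc_subset_Ici_self hy
  have hi : ∀ {f}, IsSolution A φ α β c v f → ∀ y ∈ Icc 0 (φ b),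
      Integrable fun t => kern A α β t * pull φ f (y - t) := fun {f} hf y hy => by
    obtain ⟨x, hx, rfl⟩ := hmem y hy
    exact (hφ.intervalIntegrable_integrand_iff A α β f hx).1 (hf.converges x hx)
  have h0 : ∀ y, D y = 0 := by
    refine hK.eq_zero_of_conv_eq hc' (b := φ b) ?_ (fun y hy => indicator_of_notMem hy _) ?_
    · refine IntegrableOn.integrable_indicator ?_ measurableSet_Icc
      exact ((hφ.integrableOn_dphi_mul_iff w hb).1 (hw.locL1 b hb0).2).sub
        ((hφ.integrableOn_dphi_mul_iff w' hb).1 (hw'.locL1 b hb0).2)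
    · intro y hy
      have e1 : conv (kern A α β) D y =
          conv (kern A α β) (fun y => pull φ w y - pull φ w' y) y :=
        conv_congr_Icc hK.eq_zero (fun z hz => indicator_of_notMem (fun h => by linarith [h.1]) _)
          (fun z hz => by simp [hφ.pull_of_neg _ hz])
          fun z hz => indicator_of_mem (show z ∈ Icc 0 (φ b) from ⟨hz.1, hz.2.trans hy.2⟩) _
      have e2 : conv (kern A α β) (fun y => pull φ w y - pull φ w' y) y =
          conv (kern A α β) (pull φ w) y - conv (kern A α β) (pull φ w') y := by
        rw [conv, conv, conv, ← integral_sub (hi hw y hy) (hi hw' y hy)]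
        simp only [mul_sub]
      rw [e1, e2, hD, indicator_of_mem hy]
      linear_combination hw.conv_pull hφ (hmem y hy) - hw'.conv_pull hφ (hmem y hy)
  -- `pull` may miss the value at `b` when `φ` is flat there, so `w b = w' b` is deduced from
  -- equality of the convolution terms.
  have hconv : conv (kern A α β) (pull φ w) (φ b) = conv (kern A α β) (pull φ w') (φ b) := by
    refine conv_congr_Icc hK.eq_zero (fun z hz => hφ.pull_of_neg _ hz)
      (fun z hz => hφ.pull_of_neg _ hz) fun z hz => ?_
    have := h0 z
    rw [hD, indicator_of_mem hz] at this
    exact sub_eq_zero.1 this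
  have h1 := hw.equation b hb
  have h2 := hw'.equation b hb
  rw [hφ.fracIntegral_eq A α β _ hb] at h1 h2
  rw [hconv] at h1
  exact mul_left_cancel₀ hc' (add_left_cancel (h1.trans h2.symm))

theorem isSolution_of_conv_eq (hφ : IsWeight φ) (hK : IsVolterraKernel (kern A α β))
    (hc : c ≠ 0) (hwpc : PiecewiseContinuous w) {U : ℝ → ℂ} (hUm : AEStronglyMeasurable U)
    (hU0 : ∀ y < 0, U y = 0) (hUb : ∀ b, ∃ C, 0 ≤ C ∧ ∀ y ∈ Icc 0 b, ‖U y‖ ≤ C)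
    (hwU : ∀ y ∈ φ '' Ici 0, pull φ w y = U y)
    (heq : ∀ x, 0 ≤ x → conv (kern A α β) U (φ x) + c * w x = v x) :
    IsSolution A φ α β c v w := by
  have hmem : ∀ x, 0 ≤ x → ∀ y ∈ Icc 0 (φ x), y ∈ φ '' Ici 0 := fun x hx y hy => by
    rw [← hφ.image_Icc hx] at hy
    exact image_mono Icc_subset_Ici_self hy
  have hequation : ∀ x : ℝ, 0 ≤ x → fracIntegral A φ α β w x + (c : ℂ) * w x = v x := by
    intro x hx
    rw [hφ.fracIntegral_eq A α β w hx, conv_congr_Icc hK.eq_zero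
      (fun z hz => hφ.pull_of_neg w hz) hU0 fun z hz => hwU z (hmem x hx z hz)]
    exact heq x hx
  refine ⟨fun b hb => ⟨?_, ?_⟩, fun x hx => ?_, hequation, ?_⟩
  · exact hwpc.aestronglyMeasurable.mono_measure (Measure.restrict_mono Icc_subset_Ici_self le_rfl)
  · obtain ⟨C, hC0, hC⟩ := hUb (φ b)
    rw [hφ.integrableOn_dphi_mul_iff w hb.le,
      integrableOn_congr_fun (fun y hy => hwU y (hmem b hb.le y hy)) measurableSet_Icc]
    exact Measure.integrableOn_of_bounded (M := C) (by simp) hUm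
      ((ae_restrict_iff' measurableSet_Icc).2 (Eventually.of_forall fun y hy => hC y hy))
  · obtain ⟨C, hC0, hC⟩ := hUb (φ x)
    rw [hφ.intervalIntegrable_integrand_iff A α β w hx]
    refine (hK.integrable_conv_integrand hUm hU0 hC0 hC).congr (Eventually.of_forall fun t => ?_)
    rcases le_or_gt t 0 with ht | ht
    · simp [hK.eq_zero t ht]
    · rcases lt_or_ge (φ x - t) 0 with h1 | h1
      · simp [hU0 _ h1, hφ.pull_of_neg w h1]
      · simp [hwU (φ x - t) (hmem x hx _ ⟨h1, by linarith⟩)]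
  · have h0 := hequation 0 le_rfl
    rw [fracIntegral, intervalIntegral.integral_same, zero_add] at h0
    have hc' : (c : ℂ) ≠ 0 := by exact_mod_cast hc
    rw [← h0, mul_div_cancel_left₀ _ hc']

end Solution

end Solutions

end GenFrac

end

/-! ### The main theorem -/

open GenFrac

theorem mainTheorem12
    (α β : ℂ) (hα : 0 < α.re) (hβ : 0 < β.re)
    (a : ℕ → ℂ) (A : ℂ → ℂ) (hA : ∀ z : ℂ, HasSum (fun n => a n * z ^ n) (A z))
    (φ : ℝ → ℝ) (hφ : GenFrac.IsWeight φ)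
    (c : ℝ) (hc : c ≠ 0)
    (v : ℝ → ℂ) (hv : GenFrac.PiecewiseContinuous v) (hv' : GenFrac.ExpOrder φ v) :
    ∃ u : ℝ → ℂ,
      GenFrac.PiecewiseContinuous u ∧
      GenFrac.IsSolution A φ α β c v u ∧
      (∀ w : ℝ → ℂ, GenFrac.IsSolution A φ α β c v w → EqOn w u (Ici 0)) ∧
      (Tendsto φ atTop atTop →
        (∃ r > (0 : ℝ), ∀ z : ℂ, ‖z‖ < r → Summable (GenFrac.gammaTerm a α β z)) →
        GenFrac.ExpOrder φ u ∧
        (∃ σ > (0 : ℝ), ∀ s : ℂ, σ < s.re →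
          GenFrac.LaplaceConverges φ v s ∧
          GenFrac.LaplaceConverges φ u s ∧
          Summable (GenFrac.gammaTerm a α β (s ^ (-β))) ∧
          s ^ (-α) * GenFrac.gammaTransform a α β (s ^ (-β)) + (c : ℂ) ≠ 0 ∧
          GenFrac.laplace φ u s = GenFrac.laplace φ v s /
            (s ^ (-α) * GenFrac.gammaTransform a α β (s ^ (-β)) + (c : ℂ))) ∧
        (∀ w : ℝ → ℂ,
          (∃ σ > (0 : ℝ), ∀ s : ℂ, σ < s.re →
            GenFrac.LaplaceConverges φ w s ∧
            GenFrac.laplace φ w s = GenFrac.laplace φ v s /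
              (s ^ (-α) * GenFrac.gammaTransform a α β (s ^ (-β)) + (c : ℂ))) →
          ∀ᵐ x ∂volume.restrict (Ici (0 : ℝ)), GenFrac.dphi φ x ≠ 0 → w x = u x)) := by
  have hc' : (c : ℂ) ≠ 0 := by exact_mod_cast hc
  have hK : IsVolterraKernel (kern A α β) := isVolterraKernel_kern hα hβ hA
  obtain ⟨M, κ, hM, hκ, hvb⟩ := exists_exp_bound hφ hv hv'
  have hVm : AEStronglyMeasurable (pull φ v) :=
    aestronglyMeasurable_pull_of_laplaceConverges hφ (s := ((κ + 1 : ℝ) : ℂ))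
      (laplaceConverges_of_exp_bound hφ hv.aestronglyMeasurable hvb (by simp))
  have hVb := norm_pull_le (φ := φ) hM.le hvb
  obtain ⟨U, hUm, hU0, hUb, hUc, hUe⟩ := hK.exists_solution hc' hVm
    (fun y hy => hφ.pull_of_neg v hy) hVb
  -- `u` is not `U ∘ φ`: on a flat piece of `φ` the values `v x` may vary while `U (φ x)` does not.
  set u : ℝ → ℂ := fun x => (c : ℂ)⁻¹ * (v x - conv (kern A α β) U (φ x)) with hu
  have hupc : PiecewiseContinuous u :=
    hv.const_mul_sub (hUc.comp hφ.continuousOn fun x hx => hφ.nonneg hx) _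
  have huU : ∀ y ∈ φ '' Ici 0, pull φ u y = U y := fun y hy => by
    obtain ⟨x, hx, rfl, hf⟩ := exists_pull_eq hy
    have h := hUe (φ x)
    rw [hf v] at h
    rw [hf u, hu]
    simp only [← h]
    rw [add_sub_cancel_left, inv_mul_cancel_left₀ hc']
  have husol : IsSolution A φ α β c v u := isSolution_of_conv_eq hφ hK hc hupc hUm hU0 hUb huU
    fun x hx => by simp only [hu]; rw [mul_inv_cancel_left₀ hc']; ring
  refine ⟨u, hupc, husol, fun w hw => hw.eqOn hφ hK hc husol, fun hlim hr => ?_⟩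
  obtain ⟨l, hl, hsum⟩ := exists_summable_gamma_rpow hα hβ hr
  have hlap : ∀ s : ℂ, l ≤ s.re → _ := fun s hs =>
    laplace_kern hα hβ hA (hl.trans_le hs) (hsum s.re hs)
  have hpos : 0 < ‖(c : ℂ)‖ / 2 := half_pos (norm_pos_iff.2 hc')
  -- One `r` serves twice: norm below `|c| / 2` yields both the growth bound on `u` and the
  -- non-vanishing of the denominator. `r ≥ l` gives the kernel a transform, `r ≥ κ` controls `v`.
  obtain ⟨r, hrm, hri, hrc⟩ := exists_integral_norm_damp_lt hK.eq_zero
    (hlap (l : ℂ) (by simp)).1 hpos (max l κ)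
  have hlr : l ≤ r := (le_max_left _ _).trans hrm
  have hκr : κ ≤ r := (le_max_right _ _).trans hrm
  have hr0 : 0 < r := hl.trans_le hlr
  have hexp : ∀ x, 0 ≤ x → ‖u x‖ ≤ ‖(c : ℂ)⁻¹‖ * (M + M) * Real.exp (r * φ x) := by
    intro x hx
    have hφx := hφ.nonneg hx
    have hle : ∀ y, 0 ≤ y → M * Real.exp (κ * y) ≤ M * Real.exp (r * y) := fun y hy => by gcongr
    have h1 := norm_conv_le_exp_of_solution hK.eq_zero hc' hU0 hUc hUe hri hrc.le
      (fun y hy => (hVb y).trans (hle y hy)) hφx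
    rw [hu, norm_mul, mul_assoc]
    refine mul_le_mul_of_nonneg_left ((norm_sub_le _ _).trans ?_) (norm_nonneg _)
    rw [add_mul]
    exact add_le_add ((hvb x hx).trans (hle _ hφx)) h1
  -- Here `φ → ∞` enters: the range of `φ` is all of `[0, ∞)`.
  have hpu : pull φ u = U := by
    ext y
    by_cases hy : y ∈ φ '' Ici 0
    · exact huU y hy
    · rw [pull_of_notMem u hy]
      rw [hφ.image_Ici hlim, mem_Ici, not_le] at hy
      exact (hU0 y hy).symm
  have hmain : ∀ s : ℂ, r < s.re →
      LaplaceConverges φ v s ∧ LaplaceConverges φ u s ∧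
        Summable (gammaTerm a α β (s ^ (-β))) ∧
        s ^ (-α) * gammaTransform a α β (s ^ (-β)) + (c : ℂ) ≠ 0 ∧
        laplace φ u s = laplace φ v s /
          (s ^ (-α) * gammaTransform a α β (s ^ (-β)) + (c : ℂ)) := by
    intro s hs
    obtain ⟨hki, hks, hke⟩ := hlap s (hlr.trans hs.le)
    have hLv : LaplaceConverges φ v s :=
      laplaceConverges_of_exp_bound hφ hv.aestronglyMeasurable hvb (hκr.trans_lt hs)
    have hLu : LaplaceConverges φ u s :=
      laplaceConverges_of_exp_bound hφ hupc.aestronglyMeasurable hexp hs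
    -- The transform of the kernel has modulus below `|c| / 2`, so it cannot equal `-c`.
    have hne : s ^ (-α) * gammaTransform a α β (s ^ (-β)) + (c : ℂ) ≠ 0 := by
      intro h0
      have h1 : ‖∫ y, damp s (kern A α β) y‖ ≤ ∫ y, ‖damp r (kern A α β) y‖ := by
        refine norm_integral_le_of_norm_le hri.norm (Eventually.of_forall fun y => ?_)
        rw [norm_damp, norm_damp]
        rcases le_or_gt y 0 with hy | hy
        · simp [hK.eq_zero y hy]
        · simp only [Complex.ofReal_re]
          gcongr
      rw [hke, eq_neg_of_add_eq_zero_left h0, norm_neg] at h1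
      linarith
    refine ⟨hLv, hLu, hks, hne, ?_⟩
    have hUi : Integrable (damp s U) := by
      rw [← hpu]; exact (hφ.laplaceConverges_iff u s).1 hLu
    obtain ⟨hci, hce⟩ := integral_damp_conv hki hUi
    rw [eq_div_iff hne, hφ.laplace_eq, hφ.laplace_eq, hpu]
    have e : ∀ y, damp s (pull φ v) y = damp s (conv (kern A α β) U) y + c * damp s U y :=
      fun y => by simp only [damp, ← hUe y]; ring
    simp only [e]
    rw [integral_add hci (hUi.const_mul _), integral_const_mul, hce, hke]
    ring
  refine ⟨⟨r, hr0, ‖(c : ℂ)⁻¹‖ * (M + M), ?_, 1, one_pos, fun x hx =>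
    hexp x (zero_le_one.trans hx.le)⟩, ⟨r, hr0, hmain⟩, ?_⟩
  · have : 0 < ‖(c : ℂ)⁻¹‖ := norm_pos_iff.2 (inv_ne_zero hc')
    positivity
  · rintro w ⟨σ, hσ, hw⟩
    refine hφ.ae_eq_of_pull_ae_eq (ae_eq_of_integral_damp_eq (σ := max σ r) (fun s hs => ?_)
      (fun s hs => ?_) fun s hs => ?_)
    · exact (hφ.laplaceConverges_iff w s).1 (hw s ((le_max_left _ _).trans_lt hs)).1
    · exact (hφ.laplaceConverges_iff u s).1 (hmain s ((le_max_right _ _).trans_lt hs)).2.1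
    · rw [← hφ.laplace_eq, ← hφ.laplace_eq, (hw s ((le_max_left _ _).trans_lt hs)).2,
        (hmain s ((le_max_right _ _).trans_lt hs)).2.2.2.2]
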